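/- Let $(X^*,X_*,R,\check R)$ be a reduced and irreducible root datum (so $X^*,X_*$ are free abelian groups of finite rank, dual under $\langle\ ,\ \rangle$, and $R$ is finite and non-empty), with base $\Pi$, positive roots $R^+$, and Weyl group $W_0\subset \mathrm{GL}(V)$ on $V=X_*\otimes\mathbb R$. Let $\Theta$ be an automorphism of the root datum with $\Theta(\Pi)=\Pi$; it acts on $V$, and on $W_0$ by conjugation. Let $W_0^\Theta$ be the fixed-point subgroup of $W_0$. Put $X_*^{[\Theta]}=\{x\in X_* : \langle\alpha,x-\Theta x\rangle=0\ \text{for all }\alpha\in R\}$ and $V^{[\Theta]}=X_*^{[\Theta]}\otimes\mathbb R\subset V$. For $\beta\in R$ let $\bar\Theta(\beta)$ be the average of the $\Theta$-orbit of $\beta$. Let $R^{[\Theta]}$ be the set of all $\bar\Theta(\beta)$, $\beta\in R$, except those which are smaller multiples of others, regarded as linear functionals on $V^{[\Theta]}$. For a $\Theta$-orbit $\pi\subset\Pi$ with span $V_\pi$, let $\tilde\alpha_\pi$ be any highest root of (an irreducible component of) the root system $R\cap V_\pi$ with base $\pi$; let $\Pi^{[\Theta]}$ be the set of all $\bar\Theta(\tilde\alpha_\pi)$,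 and let $R^{[\Theta]+}$ be the set of roots in $R^{[\Theta]}$ that are sums of elements of $\Pi^{[\Theta]}$. Let $(E,\Phi,\Delta)$ be $(V,R,\Pi)$ or $(V^{[\Theta]},R^{[\Theta]},\Pi^{[\Theta]})$. The alcoves of $E$ are the connected components of the complement in $E$ of all hyperplanes $H_{\alpha,k}=\{x:\langle\alpha,x\rangle=k\}$, $\alpha\in\Phi$, $k\in\mathbb Z$. The base alcove is $\{x : \langle\alpha,x\rangle>0\ \text{for all }\alpha\in\Delta,\ \langle\tilde\alpha,x\rangle<1\}$, where $\tilde\alpha$ is the highest root of $\Phi$; it is denoted $A_0$ for $V$ and $A_0^{[\Theta]}$ for $V^{[\Theta]}$. Two alcoves share the wall $H_{\alpha,k}$ if the intersection of their closures has affine span $H_{\alpha,k}$. A gallery is a finite sequence of alcoves in which any two consecutive ones share a wall. For $w\in W_0$ (if $E=V$) or $w\in W_0^\Theta$ (if $E=V^{[\Theta]}$, on which $w$ acts by restriction), a gallery $A_0',\dots,A_l'$ is in the $w$-direction if for every $i$, writing the common wall of $A_{i-1}'$ and $A_i'$ as $H_{\alpha,k}$ with $\alpha\in w(\Phi^+)$,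 one has $\langle\alpha,x\rangle<k$ on $A'_{i-1}$ and $\langle\alpha,x\rangle>k$ on $A'_i$. The acute cone $C(A,w)$ is the set of alcoves that are the end of a gallery in the $w$-direction which begins at $A$. Then: 1. For every alcove $A$ of $V$, the set $A\cap V^{[\Theta]}$ is either empty or an alcove of $V^{[\Theta]}$. 2. For every alcove $A'$ of $V^{[\Theta]}$ there is exactly one alcove $A$ of $V$ with $A'=A\cap V^{[\Theta]}$. 3. $A_0^{[\Theta]}=A_0\cap V^{[\Theta]}$. 4. Every $w\in W_0^\Theta$ restricts to a linear automorphism of $V^{[\Theta]}$, and $C(A_0^{[\Theta]},w)=C(A_0,w)\cap V^{[\Theta]}$, where the right-hand side denotes the set of alcoves of $V^{[\Theta]}$ of the form $A\cap V^{[\Theta]}$ with $A\in C(A_0,w)$. -/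

import Mathlib

open scoped TensorProduct

noncomputable section

namespace FoldedAlcoves

/-! ### Alcoves, galleries and acute cones

Here `E` is a real vector space with a topology, `Φ` is a set of linear functionals on `E`
(the roots) and `Δ ⊆ Φ` is a base (the simple roots). -/

section General

variable {E : Type*} [AddCommGroup E] [Module ℝ E]

/-- The hyperplane `H_{α,k} = {x | ⟨α, x⟩ = k}`. -/
def hyperplane (α : Module.Dual ℝ E) (k : ℤ) : Set E := {x | α x = (k : ℝ)}

/-- The open half-space `{x | ⟨α, x⟩ > k}`. -/
def posHalfSpace (α : Module.Dual ℝ E) (k : ℤ) : Set E := {x | (k : ℝ) < α x}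

/-- The open half-space `{x | ⟨α, x⟩ < k}`. -/
def negHalfSpace (α : Module.Dual ℝ E) (k : ℤ) : Set E := {x | α x < (k : ℝ)}

/-- The complement in `E` of the union of all the hyperplanes `H_{α,k}`, `α ∈ Φ`, `k ∈ ℤ`. -/
def regularSet (Φ : Set (Module.Dual ℝ E)) : Set E :=
  (⋃ α ∈ Φ, ⋃ k : ℤ, hyperplane α k)ᶜ

/-- The alcoves: the connected components of the complement of all the hyperplanes. -/
def IsAlcove [TopologicalSpace E] (Φ : Set (Module.Dual ℝ E)) (A : Set E) : Prop :=
  ∃ x ∈ regularSet Φ, A = connectedComponentIn (regularSet Φ) x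

/-- The dominant chamber `C₀ = {x | ⟨α, x⟩ > 0 for all simple α}`. -/
def dominantChamber (Δ : Set (Module.Dual ℝ E)) : Set E := {x | ∀ α ∈ Δ, 0 < α x}

/-- `θ` is the highest root: `θ - β` is a sum of simple roots for every root `β`. -/
def IsHighestRoot (Φ Δ : Set (Module.Dual ℝ E)) (θ : Module.Dual ℝ E) : Prop :=
  θ ∈ Φ ∧ ∀ β ∈ Φ, θ - β ∈ AddSubmonoid.closure Δ

/-- The base alcove `A₀ = {x ∈ C₀ | ⟨θ, x⟩ < 1}` with `θ` the highest root. -/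
def baseAlcove (Φ Δ : Set (Module.Dual ℝ E)) : Set E :=
  {x | x ∈ dominantChamber Δ ∧ ∃ θ, IsHighestRoot Φ Δ θ ∧ θ x < 1}

/-- The positive roots. -/
def positiveRoots (Φ Δ : Set (Module.Dual ℝ E)) : Set (Module.Dual ℝ E) :=
  {α | α ∈ Φ ∧ α ∈ AddSubmonoid.closure Δ}

/-- The set `w(Φ⁺)`, where `w` acts on functionals by `(wα)(x) = α(w⁻¹ x)`. -/
def movedPositiveRoots (Φ Δ : Set (Module.Dual ℝ E)) (w : E ≃ₗ[ℝ] E) :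
    Set (Module.Dual ℝ E) :=
  (fun α : Module.Dual ℝ E => α ∘ₗ (w.symm : E →ₗ[ℝ] E)) '' positiveRoots Φ Δ

variable [TopologicalSpace E]

/-- `A` and `B` share the wall `H`: their closures meet in a subset of `H` of full dimension
in `H`. -/
def ShareWall (A B H : Set E) : Prop :=
  (affineSpan ℝ (closure A ∩ closure B) : Set E) = H

/-- `g 0, …, g l` is a gallery of length `l`. -/
def IsGallery (Φ : Set (Module.Dual ℝ E)) (l : ℕ) (g : ℕ → Set E) : Prop :=
  (∀ i ≤ l, IsAlcove Φ (g i)) ∧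
  ∀ i < l, ∃ α ∈ Φ, ∃ k : ℤ, ShareWall (g i) (g (i + 1)) (hyperplane α k)

/-- The gallery `g 0, …, g l` is in the `w`-direction: writing the common wall of `g i` and
`g (i + 1)` as `H_{α,k}` with `α ∈ w(Φ⁺)`, the alcove `g i` lies in the `w`-negative half-space
and `g (i + 1)` in the `w`-positive one. -/
def InDirection (Φ Δ : Set (Module.Dual ℝ E)) (w : E ≃ₗ[ℝ] E) (l : ℕ) (g : ℕ → Set E) : Prop :=
  ∀ i < l, ∀ α ∈ movedPositiveRoots Φ Δ w, ∀ k : ℤ,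
    ShareWall (g i) (g (i + 1)) (hyperplane α k) →
      g i ⊆ negHalfSpace α k ∧ g (i + 1) ⊆ posHalfSpace α k

/-- The acute cone `C(A, w)`: all alcoves that are the end of a gallery from `A` in the
`w`-direction. -/
def acuteCone (Φ Δ : Set (Module.Dual ℝ E)) (A : Set E) (w : E ≃ₗ[ℝ] E) : Set (Set E) :=
  {A' | ∃ (l : ℕ) (g : ℕ → Set E), IsGallery Φ l g ∧ InDirection Φ Δ w l g ∧
    g 0 = A ∧ g l = A'}

end General

/-! ### The root datum and its automorphism -/

section Datum

variable {ι M N : Type*} [AddCommGroup M] [AddCommGroup N]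

/-- Irreducibility of the set of roots: it is non-empty and is not the union of two non-empty
mutually orthogonal subsets. (Mathlib's `RootPairing.IsIrreducible` is meant for coefficient
fields and does not apply over `ℤ`.) -/
def IsIrreducibleDatum (P : RootDatum ι M N) : Prop :=
  Nonempty ι ∧ ∀ s : Set ι, (∀ i ∈ s, ∀ j ∉ s, P.IsOrthogonal i j) → s = ∅ ∨ s = Set.univ

/-- `V = X_* ⊗ ℝ`. -/
abbrev CoweightSpace (N : Type*) [AddCommGroup N] : Type _ := ℝ ⊗[ℤ] N

/-- The topology of the finite-dimensional real vector space `X_* ⊗ ℝ`; subspaces of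
`X_* ⊗ ℝ` carry the induced topology. -/
instance instTopologicalSpaceCoweightSpace : TopologicalSpace (ℝ ⊗[ℤ] N) :=
  moduleTopology ℝ (ℝ ⊗[ℤ] N)

/-- A root as a linear functional on `V`. -/
def rootFun (P : RootDatum ι M N) (i : ι) : Module.Dual ℝ (CoweightSpace N) :=
  Module.Dual.baseChange ℝ (P.root' i)

/-- The roots `R`, as functionals on `V`. -/
def roots (P : RootDatum ι M N) : Set (Module.Dual ℝ (CoweightSpace N)) :=
  Set.range (rootFun P)

/-- The simple roots `Π`, as functionals on `V`. -/
def simpleRoots (P : RootDatum ι M N) (b : P.Base) : Set (Module.Dual ℝ (CoweightSpace N)) :=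
  rootFun P '' (b.support : Set ι)

/-- The reflection `s_α(x) = x - ⟨α, x⟩ α^∨` of `V`. -/
def reflectionV (P : RootDatum ι M N) (i : ι) : CoweightSpace N ≃ₗ[ℝ] CoweightSpace N :=
  LinearEquiv.baseChange ℤ ℝ N N (P.coreflection i)

/-- The Weyl group `W₀ ⊆ GL(V)`. -/
def weylGroupV (P : RootDatum ι M N) : Subgroup (CoweightSpace N ≃ₗ[ℝ] CoweightSpace N) :=
  Subgroup.closure (Set.range (reflectionV P))

/-- The action of `Θ` on `X_*`; it sends the coroot `α^∨` to `(Θα)^∨`. (Mathlib's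
`coweightEquiv` is contravariant, hence the inverse.) -/
def autN (P : RootDatum ι M N) (Θ : P.Aut) : N ≃ₗ[ℤ] N :=
  (RootPairing.Equiv.coweightEquiv P P Θ).symm

/-- The action of `Θ` on `V`. -/
def autV (P : RootDatum ι M N) (Θ : P.Aut) : CoweightSpace N ≃ₗ[ℝ] CoweightSpace N :=
  LinearEquiv.baseChange ℤ ℝ N N (autN P Θ)

/-- The fixed-point subgroup `W₀^Θ`, for the action of `Θ` on `W₀` by conjugation. -/
def fixedWeylGroup (P : RootDatum ι M N) (Θ : P.Aut) :
    Subgroup (CoweightSpace N ≃ₗ[ℝ] CoweightSpace N) :=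
  weylGroupV P ⊓ Subgroup.centralizer {autV P Θ}

/-- `X_*^{[Θ]} = {x ∈ X_* | ⟨α, x - Θ x⟩ = 0 for all α ∈ R}`. -/
def foldedLattice (P : RootDatum ι M N) (Θ : P.Aut) : Submodule ℤ N :=
  ⨅ i, LinearMap.ker (P.root' i ∘ₗ (LinearMap.id - (autN P Θ : N →ₗ[ℤ] N)))

/-- `V^{[Θ]} = X_*^{[Θ]} ⊗ ℝ`, as a subspace of `V`. -/
def foldedSpace (P : RootDatum ι M N) (Θ : P.Aut) : Submodule ℝ (CoweightSpace N) :=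
  (foldedLattice P Θ).baseChange ℝ

/-- The (indices of the) roots in the `Θ`-orbit of the root `i`. -/
def orbit (P : RootDatum ι M N) (Θ : P.Aut) (i : ι) : Set ι :=
  {j | Equiv.Perm.SameCycle (Θ.indexEquiv : Equiv.Perm ι) i j}

/-- The average of the `Θ`-orbit of the root `i`. -/
def orbitAverage (P : RootDatum ι M N) (Θ : P.Aut) (i : ι) :
    Module.Dual ℝ (CoweightSpace N) :=
  ((orbit P Θ i).ncard : ℝ)⁻¹ • ∑ᶠ j ∈ orbit P Θ i, rootFun P j

/-- The root `j` is a highest root of the (possibly reducible) root system `R ∩ V_π` with base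
`π`, where `V_π` is the span of `π`: it is maximal for the order in which `α ≤ β` if `β - α` is a
sum of elements of `π`. So `j` is the highest root of an irreducible component of `R ∩ V_π`. -/
def IsHighestIn (P : RootDatum ι M N) (π : Set ι) (j : ι) : Prop :=
  rootFun P j ∈ Submodule.span ℝ (rootFun P '' π) ∧
  ∀ m : ι, rootFun P m ∈ Submodule.span ℝ (rootFun P '' π) →
    rootFun P m - rootFun P j ∈ AddSubmonoid.closure (rootFun P '' π) → m = j

/-- Restriction of functionals from `V` to `V^{[Θ]}`. -/
def restrictFun (P : RootDatum ι M N) (Θ : P.Aut) (f : Module.Dual ℝ (CoweightSpace N)) :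
    Module.Dual ℝ (foldedSpace P Θ) :=
  f ∘ₗ (foldedSpace P Θ).subtype

/-- `R^{[Θ]}`, as functionals on `V^{[Θ]}`: all orbit averages of roots, except those which are
smaller multiples of others. -/
def foldedRoots (P : RootDatum ι M N) (Θ : P.Aut) : Set (Module.Dual ℝ (foldedSpace P Θ)) :=
  restrictFun P Θ '' {f | (∃ i, f = orbitAverage P Θ i) ∧
    ¬ ∃ (j : ι) (c : ℝ), 0 < c ∧ c < 1 ∧ f = c • orbitAverage P Θ j}

/-- `Π^{[Θ]}`, as functionals on `V^{[Θ]}`: the orbit averages of the highest roots of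
`R ∩ V_π`, for the `Θ`-orbits `π ⊆ Π`. -/
def foldedSimpleRoots (P : RootDatum ι M N) (b : P.Base) (Θ : P.Aut) :
    Set (Module.Dual ℝ (foldedSpace P Θ)) :=
  {f | ∃ i ∈ b.support, ∃ j, IsHighestIn P (orbit P Θ i) j ∧
    f = restrictFun P Θ (orbitAverage P Θ j)}

/-- `A ∩ V^{[Θ]}`, as a subset of `V^{[Θ]}`. -/
def interFolded (P : RootDatum ι M N) (Θ : P.Aut) (A : Set (CoweightSpace N)) :
    Set (foldedSpace P Θ) :=
  (Subtype.val : foldedSpace P Θ → CoweightSpace N) ⁻¹' A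

end Datum

end FoldedAlcoves

end

open FoldedAlcoves

open scoped TensorProduct

noncomputable section

namespace FoldedAlcoves

/-! ### Alcoves as sets of points with prescribed integer parts -/

section Alcoves

variable {E : Type*} [AddCommGroup E] [Module ℝ E]

-- The hyperplanes see only the integer parts of the roots. On a connected set of regular points a
-- root avoids `ℤ`, so its integer part is constant; conversely, the regular points with prescribed
-- integer parts form a convex set. The alcoves are therefore the cells `floorCell Φ x`
-- (`connectedComponentIn_regularSet`). On `V^{[Θ]}` a root agrees with the average of its orbit, so
-- a cell of `V` is cut out there by the restrictions of all roots, whereas the folded system keeps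
-- only the long ones.
--
-- The discarded restrictions do no harm, because each is exactly half of a long one. Roots in one
-- orbit have the same height, so two distinct ones cannot have positive pairing: their difference
-- would be a root of height zero. Together with positivity of the invariant form this shows that a
-- root pairs to 1 or 2 with the sum of the coroots in its orbit, and a proportionality factor
-- strictly between 0 and 1 must be 1/2. Since `⌊u/2⌋` is a monotone function of `⌊u⌋`, the long
-- roots determine the cells (`interFolded_floorCell`). This gives the first two claims.
--
-- For the base alcoves, the highest root of `R` must restrict to the highest root of the folded
-- system. This rests on `restrictedRoot_mem_closure`: positive long restrictions are sums of folded
-- simple roots. The proof is by induction on the height, using the product of the reflections in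
-- the orbit of a highest root of `R ∩ V_π`, whose members are pairwise orthogonal.
--
-- For the acute cones, `mem_acuteCone_iff` eliminates galleries: `A'` lies in `C(A,w)` if and only
-- if no root of `w(Φ⁺)` has a smaller integer part on `A'` than on `A`. An element of `W₀^Θ`
-- permutes the roots and preserves `V^{[Θ]}`, so the criteria in `V` and in `V^{[Θ]}` differ only
-- by the discarded roots, and these are handled by the monotonicity of halving.

lemma mem_regularSet {Φ : Set (Module.Dual ℝ E)} {x : E} :
    x ∈ regularSet Φ ↔ ∀ α ∈ Φ, ∀ k : ℤ, α x ≠ k := by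
  simp [regularSet, hyperplane]

/-- The points of `regularSet Φ` at which every root has the same integer part as at `x`. -/
def floorCell (Φ : Set (Module.Dual ℝ E)) (x : E) : Set E :=
  {y | y ∈ regularSet Φ ∧ ∀ α ∈ Φ, ⌊α y⌋ = ⌊α x⌋}

/-- The strict lower bound carries the regularity: a regular value is never equal to its integer
part. -/
lemma mem_floorCell_iff {Φ : Set (Module.Dual ℝ E)} {x y : E} :
    y ∈ floorCell Φ x ↔ ∀ α ∈ Φ, (⌊α x⌋ : ℝ) < α y ∧ α y < ⌊α x⌋ + 1 := by
  constructor
  · rintro ⟨hy, h⟩ α hα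
    rw [← h α hα]
    refine ⟨lt_of_le_of_ne (Int.floor_le _) fun e => ?_, Int.lt_floor_add_one _⟩
    exact mem_regularSet.1 hy α hα _ e.symm
  · intro h
    refine ⟨mem_regularSet.2 fun α hα k hk => ?_, fun α hα => ?_⟩
    · obtain ⟨h1, h2⟩ := h α hα
      rw [hk] at h1 h2
      norm_cast at h1 h2
      omega
    · rw [Int.floor_eq_iff]
      exact ⟨(h α hα).1.le, (h α hα).2⟩

lemma floorCell_convex (Φ : Set (Module.Dual ℝ E)) (x : E) : Convex ℝ (floorCell Φ x) := by
  have : floorCell Φ x =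
      ⋂ α ∈ Φ, {y | (⌊α x⌋ : ℝ) < α y} ∩ {y | α y < (⌊α x⌋ : ℝ) + 1} := by
    ext y
    simp [mem_floorCell_iff]
  rw [this]
  refine convex_iInter₂ fun α _ => Convex.inter ?_ ?_
  · exact convex_halfSpace_gt α.isLinear _
  · exact convex_halfSpace_lt α.isLinear _

lemma self_mem_floorCell {Φ : Set (Module.Dual ℝ E)} {x : E} (hx : x ∈ regularSet Φ) :
    x ∈ floorCell Φ x := ⟨hx, fun _ _ => rfl⟩

variable [TopologicalSpace E] [ContinuousAdd E] [ContinuousSMul ℝ E]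

/-- The image of a component under a root is an interval without integers, which bounds the
component by the cell; the cell is convex, which gives the other inclusion. -/
lemma connectedComponentIn_regularSet {Φ : Set (Module.Dual ℝ E)}
    (hc : ∀ α ∈ Φ, Continuous α) {x : E} (hx : x ∈ regularSet Φ) :
    connectedComponentIn (regularSet Φ) x = floorCell Φ x := by
  apply Set.Subset.antisymm
  · intro y hy
    have hyr : y ∈ regularSet Φ := connectedComponentIn_subset _ _ hy
    refine ⟨hyr, fun α hα => ?_⟩
    have hpre : IsPreconnected (α '' connectedComponentIn (regularSet Φ) x) :=
      isPreconnected_connectedComponentIn.image _ (hc α hα).continuousOn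
    have hxm : α x ∈ α '' connectedComponentIn (regularSet Φ) x :=
      ⟨x, mem_connectedComponentIn hx, rfl⟩
    have hym : α y ∈ α '' connectedComponentIn (regularSet Φ) x := ⟨y, hy, rfl⟩
    have key : ∀ k : ℤ, (k : ℝ) ∉ α '' connectedComponentIn (regularSet Φ) x := by
      rintro k ⟨z, hz, hzk⟩
      exact mem_regularSet.1 (connectedComponentIn_subset _ _ hz) α hα k hzk
    by_contra hne
    rcases lt_or_gt_of_ne hne with h | h
    · exact key ⌊α x⌋ (hpre.Icc_subset hym hxm
        ⟨(Int.floor_lt.1 h).le, Int.floor_le _⟩)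
    · exact key ⌊α y⌋ (hpre.Icc_subset hxm hym
        ⟨(Int.floor_lt.1 h).le, Int.floor_le _⟩)
  · exact (floorCell_convex Φ x).isPreconnected.subset_connectedComponentIn
      (self_mem_floorCell hx) fun y hy => hy.1

lemma isAlcove_iff {Φ : Set (Module.Dual ℝ E)} (hc : ∀ α ∈ Φ, Continuous α) {A : Set E} :
    IsAlcove Φ A ↔ ∃ x ∈ regularSet Φ, A = floorCell Φ x := by
  constructor
  · rintro ⟨x, hx, rfl⟩
    exact ⟨x, hx, connectedComponentIn_regularSet hc hx⟩
  · rintro ⟨x, hx, rfl⟩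
    exact ⟨x, hx, (connectedComponentIn_regularSet hc hx).symm⟩

omit [TopologicalSpace E] [ContinuousAdd E] [ContinuousSMul ℝ E] in
lemma floorCell_eq_of_mem {Φ : Set (Module.Dual ℝ E)} {x y : E} (hy : y ∈ floorCell Φ x) :
    floorCell Φ y = floorCell Φ x := by
  ext z
  simp only [mem_floorCell_iff]
  exact forall₂_congr fun α hα => by rw [hy.2 α hα]

lemma IsAlcove.eq_floorCell {Φ : Set (Module.Dual ℝ E)} (hc : ∀ α ∈ Φ, Continuous α) {A : Set E}
    (hA : IsAlcove Φ A) {x : E} (hx : x ∈ A) : A = floorCell Φ x := by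
  obtain ⟨y, -, rfl⟩ := (isAlcove_iff hc).1 hA
  exact (floorCell_eq_of_mem hx).symm

omit [ContinuousAdd E] [ContinuousSMul ℝ E] in
lemma IsAlcove.nonempty {Φ : Set (Module.Dual ℝ E)} {A : Set E}
    (hA : IsAlcove Φ A) : A.Nonempty := by
  obtain ⟨x, hx, rfl⟩ := hA
  exact ⟨x, mem_connectedComponentIn hx⟩

lemma isAlcove_floorCell {Φ : Set (Module.Dual ℝ E)} (hc : ∀ α ∈ Φ, Continuous α) {x : E}
    (hx : x ∈ regularSet Φ) : IsAlcove Φ (floorCell Φ x) :=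
  (isAlcove_iff hc).2 ⟨x, hx, rfl⟩

omit [ContinuousAdd E] [ContinuousSMul ℝ E] in
lemma isOpen_floorCell {Φ : Set (Module.Dual ℝ E)} (hΦ : Φ.Finite) (hc : ∀ α ∈ Φ, Continuous α)
    (x : E) : IsOpen (floorCell Φ x) := by
  have : floorCell Φ x =
      ⋂ α ∈ Φ, {y | (⌊α x⌋ : ℝ) < α y} ∩ {y | α y < (⌊α x⌋ : ℝ) + 1} := by
    ext y
    simp [mem_floorCell_iff]
  rw [this]
  refine hΦ.isOpen_biInter fun α hα => IsOpen.inter ?_ ?_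
  · exact isOpen_lt continuous_const (hc α hα)
  · exact isOpen_lt (hc α hα) continuous_const

end Alcoves

/-! ### Walls -/

section Walls

variable {E : Type*} [AddCommGroup E] [Module ℝ E]

lemma exists_smul_of_ker_le {α β : Module.Dual ℝ E} (hα : α ≠ 0)
    (h : ∀ x, α x = 0 → β x = 0) : ∃ c : ℝ, β = c • α := by
  obtain ⟨u, hu⟩ : ∃ u, α u ≠ 0 := by
    by_contra! hh
    exact hα (LinearMap.ext hh)
  refine ⟨β u / α u, LinearMap.ext fun x => ?_⟩
  have := h (x - (α x / α u) • u) (by simp [hu])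
  simp only [map_sub, map_smul, smul_eq_mul] at this
  simp only [LinearMap.smul_apply, smul_eq_mul]
  field_simp at this ⊢
  linarith

lemma hyperplane_nonempty {α : Module.Dual ℝ E} (hα : α ≠ 0) (k : ℤ) :
    (hyperplane α k).Nonempty := by
  obtain ⟨u, hu⟩ : ∃ u, α u ≠ 0 := by
    by_contra! hh
    exact hα (LinearMap.ext hh)
  exact ⟨((k : ℝ) / α u) • u, by simp [hyperplane, hu]⟩

lemma exists_smul_of_hyperplane_subset {α β : Module.Dual ℝ E} (hα : α ≠ 0) {k m : ℤ}
    (h : hyperplane α k ⊆ hyperplane β m) : ∃ c : ℝ, β = c • α := by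
  refine exists_smul_of_ker_le hα fun x hx => ?_
  obtain ⟨y, hy⟩ := hyperplane_nonempty hα k
  have h1 : β y = m := h hy
  have h2 : β (y + x) = m := h (by
    have : α y = k := hy
    simp [hyperplane, hx, this])
  rw [map_add, h1] at h2
  linarith

/-- A hyperplane as an affine subspace. -/
def affineHyperplane (α : Module.Dual ℝ E) (k : ℤ) : AffineSubspace ℝ E where
  carrier := hyperplane α k
  smul_vsub_vadd_mem' := by
    intro c p q r hp hq hr
    have hp' : α p = k := hp
    have hq' : α q = k := hq
    have hr' : α r = k := hr
    simp [hyperplane, hp', hq', hr']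

lemma affineSpan_subset_hyperplane {α : Module.Dual ℝ E} {k : ℤ} {S : Set E}
    (h : S ⊆ hyperplane α k) : (affineSpan ℝ S : Set E) ⊆ hyperplane α k :=
  affineSpan_le (Q := affineHyperplane α k) |>.2 h

variable [TopologicalSpace E]

lemma closure_le {α : Module.Dual ℝ E} (hc : Continuous α) {A : Set E} {r : ℝ}
    (h : ∀ x ∈ A, α x ≤ r) {x : E} (hx : x ∈ closure A) : α x ≤ r :=
  closure_minimal (t := {y | α y ≤ r}) h (isClosed_le hc continuous_const) hx

lemma le_closure {α : Module.Dual ℝ E} (hc : Continuous α) {A : Set E} {r : ℝ}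
    (h : ∀ x ∈ A, r ≤ α x) {x : E} (hx : x ∈ closure A) : r ≤ α x :=
  closure_minimal (t := {y | r ≤ α y}) h (isClosed_le continuous_const hc) hx

/-- If a wall shared by `A` and `B` is `H_{α,k}` and a hyperplane `H_{β,m}` separates `A` and `B`,
then `β` is proportional to `α`. -/
lemma ShareWall.exists_smul {A B : Set E} {α β : Module.Dual ℝ E} (hα : α ≠ 0)
    (hβ : Continuous β) {k m : ℤ} (h : ShareWall A B (hyperplane α k))
    (hA : ∀ x ∈ A, β x ≤ m) (hB : ∀ x ∈ B, m ≤ β x) : ∃ c : ℝ, β = c • α := by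
  refine exists_smul_of_hyperplane_subset hα (k := k) (m := m) ?_
  rw [ShareWall] at h
  rw [← h]
  exact affineSpan_subset_hyperplane fun x hx =>
    le_antisymm (closure_le hβ hA hx.1) (le_closure hβ hB hx.2)

end Walls

/-! ### Acute cones in terms of integer parts -/

section Cones

variable {E : Type*} [AddCommGroup E] [Module ℝ E] [TopologicalSpace E] [ContinuousAdd E]
  [ContinuousSMul ℝ E]

/-- The floors of the roots in `Ψ` can only increase along a gallery in the direction of `Ψ`. -/
lemma floor_le_of_shareWall {Φ Ψ : Set (Module.Dual ℝ E)}
    (hc : ∀ α ∈ Φ, Continuous α) (h0 : ∀ α ∈ Φ, α ≠ 0) (hΨ : Ψ ⊆ Φ)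
    (hprop : ∀ α ∈ Ψ, ∀ β ∈ Ψ, ∀ c : ℝ, β = c • α → β = α)
    {A B : Set E} (hA : IsAlcove Φ A) (hB : IsAlcove Φ B) {α : Module.Dual ℝ E} (hα : α ∈ Ψ)
    {k : ℤ} (hw : ShareWall A B (hyperplane α k)) (hneg : A ⊆ negHalfSpace α k)
    (hpos : B ⊆ posHalfSpace α k) {β : Module.Dual ℝ E} (hβ : β ∈ Ψ) {x y : E} (hx : x ∈ A)
    (hy : y ∈ B) : ⌊β x⌋ ≤ ⌊β y⌋ := by
  by_cases hβα : β = α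
  · subst hβα
    exact Int.floor_mono ((hneg hx).trans (hpos hy)).le
  -- If `⌊β⌋` dropped, `H_{β,⌊β x⌋}` would weakly separate the two alcoves, so it would contain
  -- their common wall and `β` would be proportional to `α`.
  · by_contra! hlt
    rw [hA.eq_floorCell hc hx, hB.eq_floorCell hc hy] at hw
    have hw' : ShareWall (floorCell Φ y) (floorCell Φ x) (hyperplane α k) := by
      rwa [ShareWall, Set.inter_comm]
    obtain ⟨c, hcc⟩ := hw'.exists_smul (h0 α (hΨ hα)) (hc β (hΨ hβ)) (m := ⌊β x⌋)
      (fun z hz => by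
        have h1 := (mem_floorCell_iff.1 hz β (hΨ hβ)).2
        have h2 : ((⌊β y⌋ + 1 : ℤ) : ℝ) ≤ ⌊β x⌋ := by exact_mod_cast hlt
        push_cast at h2
        linarith)
      (fun z hz => (mem_floorCell_iff.1 hz β (hΨ hβ)).1.le)
    exact hβα (hprop α hα β hβ c hcc)

omit [ContinuousAdd E] in
/-- A generic point of an open set, avoiding finitely many hyperplanes. -/
lemma exists_mem_forall_ne {κ : Type*} [Finite κ] {U : Set E} [ContinuousAdd E]
    (hU : IsOpen U) (hne : U.Nonempty) (f : κ → Module.Dual ℝ E) (hf : ∀ i, f i ≠ 0) (r : κ → ℝ) :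
    ∃ y ∈ U, ∀ i, f i y ≠ r i := by
  obtain ⟨u, hu⟩ := hne
  -- On a line whose direction is killed by no `f i`, each condition excludes a single parameter.
  obtain ⟨v, hv⟩ := Module.Dual.exists_forall_ne_zero_of_forall_exists f fun i => by
    by_contra! hh
    exact hf i (LinearMap.ext hh)
  have hcont : Continuous fun t : ℝ => u + t • v := by fun_prop
  have hopen : IsOpen ((fun t : ℝ => u + t • v) ⁻¹' U) := hU.preimage hcont
  have h0 : (0 : ℝ) ∈ (fun t : ℝ => u + t • v) ⁻¹' U := by simpa using hu
  have hinf : ((fun t : ℝ => u + t • v) ⁻¹' U).Infinite :=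
    infinite_of_mem_nhds 0 (hopen.mem_nhds h0)
  have hfin : (Set.range fun i => (r i - f i u) / f i v).Finite := Set.finite_range _
  obtain ⟨t, ht, ht'⟩ := (hinf.sdiff hfin).nonempty
  refine ⟨u + t • v, ht, fun i hi => ht' ⟨i, ?_⟩⟩
  simp only [map_add, map_smul, smul_eq_mul] at hi
  have := hv i
  field_simp
  linarith

/-- Crossing a wall: if the floors of the roots in `Ψ` at `A` are at most those at a different
alcove `A'`, there is an alcove `B` adjacent to `A` in the direction of `A'`. -/
lemma exists_adjacent {Φ Ψ : Set (Module.Dual ℝ E)} (hΦ : Φ.Finite)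
    (hc : ∀ α ∈ Φ, Continuous α) (hΨ : Ψ ⊆ Φ)
    (hΦΨ : ∀ α ∈ Φ, α ∈ Ψ ∨ -α ∈ Ψ)
    (hprop : ∀ α ∈ Ψ, ∀ β ∈ Ψ, ∀ c : ℝ, β = c • α → β = α)
    {x y : E} (hx : x ∈ regularSet Φ) (hy : y ∈ regularSet Φ)
    (hle : ∀ α ∈ Ψ, ⌊α x⌋ ≤ ⌊α y⌋) {γ : Module.Dual ℝ E} (hγ : γ ∈ Ψ) (hlt : ⌊γ x⌋ < ⌊γ y⌋) :
    ∃ α ∈ Ψ, ∃ z ∈ regularSet Φ, ⌊α z⌋ = ⌊α x⌋ + 1 ∧ ⌊α z⌋ ≤ ⌊α y⌋ ∧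
      (∀ β ∈ Ψ, β ≠ α → ⌊β z⌋ = ⌊β x⌋) ∧
      ShareWall (floorCell Φ x) (floorCell Φ z) (hyperplane α (⌊α z⌋)) := by
  have hΨfin : Ψ.Finite := hΦ.subset hΨ
  have hreg : ∀ z : E, (∀ β ∈ Ψ, ∀ k : ℤ, β z ≠ k) → z ∈ regularSet Φ := by
    intro z hz
    refine mem_regularSet.2 fun α hα k hk => ?_
    rcases hΦΨ α hα with h | h
    · exact hz α h k hk
    · exact hz (-α) h (-k) (by simp [hk])
  have hcell : ∀ u z : E, (∀ β ∈ Ψ, (⌊β u⌋ : ℝ) < β z ∧ β z < ⌊β u⌋ + 1) → u ∈ regularSet Φ →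
      z ∈ floorCell Φ u := by
    intro u z hz hu
    refine mem_floorCell_iff.2 fun α hα => ?_
    rcases hΦΨ α hα with h | h
    · exact hz α h
    · have h1 := hz (-α) h
      have h2 := mem_floorCell_iff.1 (self_mem_floorCell hu) α hα
      have h3 : ⌊(-α) u⌋ = -⌊α u⌋ - 1 := by
        rw [Int.floor_eq_iff]
        simp only [LinearMap.neg_apply]
        push_cast
        constructor <;> linarith [h2.1, h2.2]
      rw [h3] at h1
      simp only [LinearMap.neg_apply] at h1
      push_cast at h1
      constructor <;> linarith [h1.1, h1.2]
  have hxΨ : ∀ β ∈ Ψ, (⌊β x⌋ : ℝ) < β x ∧ β x < ⌊β x⌋ + 1 := fun β hβ =>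
    mem_floorCell_iff.1 (self_mem_floorCell hx) β (hΨ hβ)
  -- a generic end point
  have : Finite Ψ := hΨfin
  let T := {p : Ψ × Ψ // p.1 ≠ p.2}
  -- For two roots of `Ψ`, the excluded equation says that both reach their next integer at the same
  -- time on the segment from `x` to `y'`. Avoiding it for all pairs makes the segment cross one
  -- wall at a time.
  obtain ⟨y', hy', hgen⟩ := exists_mem_forall_ne (κ := T)
    (isOpen_floorCell hΦ hc y) ⟨y, self_mem_floorCell hy⟩
    (fun p => ((⌊p.1.1.1 x⌋ : ℝ) + 1 - p.1.1.1 x) • p.1.2.1 -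
      ((⌊p.1.2.1 x⌋ : ℝ) + 1 - p.1.2.1 x) • p.1.1.1)
    (fun p h => by
      have hpos : (0 : ℝ) < (⌊p.1.1.1 x⌋ : ℝ) + 1 - p.1.1.1 x := by
        linarith [(hxΨ _ p.1.1.2).2]
      refine p.2 (Subtype.ext (hprop _ p.1.1.2 _ p.1.2.2
        (((⌊p.1.1.1 x⌋ : ℝ) + 1 - p.1.1.1 x)⁻¹ * ((⌊p.1.2.1 x⌋ : ℝ) + 1 - p.1.2.1 x)) ?_).symm)
      rw [sub_eq_zero] at h
      rw [mul_smul, ← h, smul_smul, inv_mul_cancel₀ hpos.ne', one_smul])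
    (fun p => ((⌊p.1.1.1 x⌋ : ℝ) + 1 - p.1.1.1 x) * p.1.2.1 x -
      ((⌊p.1.2.1 x⌋ : ℝ) + 1 - p.1.2.1 x) * p.1.1.1 x)
  have hyΨ : ∀ β ∈ Ψ, (⌊β y⌋ : ℝ) < β y' ∧ β y' < ⌊β y⌋ + 1 := fun β hβ =>
    mem_floorCell_iff.1 hy' β (hΨ hβ)
  -- the first crossing
  let C : Set (Module.Dual ℝ E) := {α | α ∈ Ψ ∧ ⌊α x⌋ < ⌊α y⌋}
  have hCfin : C.Finite := hΨfin.subset fun α h => h.1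
  -- The time at which the segment from `x` to `y'` meets `H_{α,⌊α x⌋+1}`. The root in `C` with the
  -- smallest time gives the first wall.
  let t : Module.Dual ℝ E → ℝ := fun α => ((⌊α x⌋ : ℝ) + 1 - α x) / (α y' - α x)
  obtain ⟨α, hαC, hmin⟩ := Set.exists_min_image C t hCfin ⟨γ, hγ, hlt⟩
  have hd : ∀ β ∈ C, (⌊β x⌋ : ℝ) + 1 < β y' := by
    intro β hβ
    have h1 : ((⌊β x⌋ + 1 : ℤ) : ℝ) ≤ ⌊β y⌋ := by exact_mod_cast hβ.2
    push_cast at h1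
    linarith [(hyΨ β hβ.1).1]
  have hden : ∀ β ∈ C, 0 < β y' - β x := fun β hβ => by
    linarith [hd β hβ, (hxΨ β hβ.1).2]
  have htpos : ∀ β ∈ C, 0 < t β := fun β hβ =>
    div_pos (by linarith [(hxΨ β hβ.1).2]) (hden β hβ)
  have htlt : t α < 1 := by
    rw [div_lt_one (hden α hαC)]
    linarith [hd α hαC]
  have hmin' : ∀ β ∈ C, β ≠ α → t α < t β := by
    intro β hβ hne
    refine lt_of_le_of_ne (hmin β hβ) fun heq => ?_
    have := hgen ⟨(⟨α, hαC.1⟩, ⟨β, hβ.1⟩), fun h => hne (congrArg Subtype.val h).symm⟩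
    apply this
    simp only [t] at heq
    rw [div_eq_div_iff (hden α hαC).ne' (hden β hβ).ne'] at heq
    simp only [LinearMap.sub_apply, LinearMap.smul_apply, smul_eq_mul]
    linarith
  set p : E := x + t α • (y' - x) with hp
  have hpv : ∀ β : Module.Dual ℝ E, β p = β x + t α * (β y' - β x) := fun β => by simp [hp]
  have hpα : α p = ⌊α x⌋ + 1 := by
    rw [hpv]
    have := (hden α hαC).ne'
    simp only [t]
    field_simp
    ring
  have hpβ : ∀ β ∈ Ψ, β ≠ α → (⌊β x⌋ : ℝ) < β p ∧ β p < ⌊β x⌋ + 1 := by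
    intro β hβ hne
    rw [hpv]
    have h1 := hxΨ β hβ
    have h2 := hyΨ β hβ
    have h3 := htpos α hαC
    rcases (hle β hβ).lt_or_eq with h | h
    · have h4 := hden β ⟨hβ, h⟩
      have h5 := hmin' β ⟨hβ, h⟩ hne
      constructor
      · nlinarith
      · rw [lt_div_iff₀ h4] at h5
        linarith
    · rw [← h] at h2
      constructor <;> nlinarith
  -- a point just beyond `p`
  obtain ⟨ε, hε, hεlt⟩ : ∃ ε : ℝ, 0 < ε ∧ ∀ β ∈ Ψ,
      (β ≠ α → (⌊β x⌋ : ℝ) < β (p + ε • (y' - x)) ∧ β (p + ε • (y' - x)) < ⌊β x⌋ + 1) ∧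
      (β = α → β (p + ε • (y' - x)) < ⌊β x⌋ + 2) := by
    have hev : ∀ β ∈ Ψ, ∀ᶠ ε : ℝ in nhdsWithin 0 (Set.Ioi 0),
      (β ≠ α → (⌊β x⌋ : ℝ) < β (p + ε • (y' - x)) ∧ β (p + ε • (y' - x)) < ⌊β x⌋ + 1) ∧
      (β = α → β (p + ε • (y' - x)) < ⌊β x⌋ + 2) := by
      intro β hβ
      have hcont : Continuous fun ε : ℝ => β (p + ε • (y' - x)) := by
        have := hc β (hΨ hβ)
        fun_prop
      have hlim : Filter.Tendsto (fun ε : ℝ => β (p + ε • (y' - x))) (nhdsWithin 0 (Set.Ioi 0))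
          (nhds (β p)) := by
        have := hcont.tendsto 0
        simp only [zero_smul, add_zero] at this
        exact this.mono_left nhdsWithin_le_nhds
      by_cases hne : β = α
      · subst hne
        have : β p < ⌊β x⌋ + 2 := by rw [hpα]; linarith
        filter_upwards [hlim.eventually_lt_const this] with ε hε
        exact ⟨fun h => absurd rfl h, fun _ => hε⟩
      · obtain ⟨h1, h2⟩ := hpβ β hβ hne
        filter_upwards [hlim.eventually_lt_const h2, hlim.eventually_const_lt h1] with ε h3 h4
        exact ⟨fun _ => ⟨h4, h3⟩, fun h => absurd h hne⟩
    have hall := (Filter.eventually_all_finite hΨfin).2 hev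
    obtain ⟨ε, h1, h2⟩ := (hall.and self_mem_nhdsWithin).exists
    exact ⟨ε, h2, h1⟩
  set z : E := p + ε • (y' - x) with hz
  have hzα : (⌊α x⌋ : ℝ) + 1 < α z := by
    simp only [hz, map_add, map_smul, hpα, map_sub, smul_eq_mul]
    have := mul_pos hε (hden α hαC)
    linarith
  have hfα : ⌊α z⌋ = ⌊α x⌋ + 1 := by
    rw [Int.floor_eq_iff]
    push_cast
    exact ⟨hzα.le, by linarith [(hεlt α hαC.1).2 rfl]⟩
  have hfβ : ∀ β ∈ Ψ, β ≠ α → ⌊β z⌋ = ⌊β x⌋ := by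
    intro β hβ hne
    obtain ⟨h1, h2⟩ := (hεlt β hβ).1 hne
    exact Int.floor_eq_iff.2 ⟨h1.le, h2⟩
  have hzreg : z ∈ regularSet Φ := by
    refine hreg z fun β hβ k hk => ?_
    by_cases hne : β = α
    · subst hne
      have h1 : ⌊β z⌋ = k := by rw [hk, Int.floor_intCast]
      rw [hfα] at h1
      rw [hk, ← h1] at hzα
      push_cast at hzα
      linarith
    · obtain ⟨h1, h2⟩ := (hεlt β hβ).1 hne
      rw [hk] at h1 h2
      norm_cast at h1 h2
      omega
  refine ⟨α, hαC.1, z, hzreg, hfα, by rw [hfα]; exact hαC.2, hfβ, ?_⟩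
  -- the common wall
  have hzΨ : ∀ β ∈ Ψ, (⌊β z⌋ : ℝ) < β z ∧ β z < ⌊β z⌋ + 1 := fun β hβ =>
    mem_floorCell_iff.1 (self_mem_floorCell hzreg) β (hΨ hβ)
  have hseg : ∀ (u q : E), Continuous fun s : ℝ => q + s • (u - q) := fun u q => by fun_prop
  -- A point of the hyperplane at which the other roots keep their integer parts strictly is a limit
  -- of points of both alcoves, along the segments towards `x` and `z`.
  have hclos : ∀ q : E, α q = ⌊α x⌋ + 1 →
      (∀ β ∈ Ψ, β ≠ α → (⌊β x⌋ : ℝ) < β q ∧ β q < ⌊β x⌋ + 1) →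
      q ∈ closure (floorCell Φ x) ∩ closure (floorCell Φ z) := by
    intro q hqα hqβ
    have main : ∀ u ∈ regularSet Φ,
        (∀ s : ℝ, 0 < s → s < 1 → ∀ β ∈ Ψ,
          (⌊β u⌋ : ℝ) < β (q + s • (u - q)) ∧ β (q + s • (u - q)) < ⌊β u⌋ + 1) →
        q ∈ closure (floorCell Φ u) := by
      intro u hu h
      have hlim : Filter.Tendsto (fun s : ℝ => q + s • (u - q)) (nhdsWithin 0 (Set.Ioi 0))
          (nhds q) := by
        have := (hseg u q).tendsto 0
        simp only [zero_smul, add_zero] at this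
        exact this.mono_left nhdsWithin_le_nhds
      refine mem_closure_of_tendsto hlim ?_
      filter_upwards [self_mem_nhdsWithin,
        mem_nhdsWithin_of_mem_nhds (Iio_mem_nhds (zero_lt_one' ℝ))] with s hs hs'
      exact hcell u _ (h s hs hs') hu
    constructor
    · refine main x hx fun s hs hs' β hβ => ?_
      simp only [map_add, map_smul, map_sub, smul_eq_mul]
      have h1 := hxΨ β hβ
      by_cases hne : β = α
      · subst hne
        rw [hqα]
        constructor <;> nlinarith
      · obtain ⟨h2, h3⟩ := hqβ β hβ hne
        constructor <;> nlinarith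
    · refine main z hzreg fun s hs hs' β hβ => ?_
      simp only [map_add, map_smul, map_sub, smul_eq_mul]
      have h1 := hzΨ β hβ
      by_cases hne : β = α
      · subst hne
        rw [hqα]
        rw [hfα] at h1 ⊢
        push_cast at h1 ⊢
        constructor <;> nlinarith
      · obtain ⟨h2, h3⟩ := hqβ β hβ hne
        rw [hfβ β hβ hne] at h1 ⊢
        constructor <;> nlinarith
  rw [ShareWall, hfα]
  refine Set.Subset.antisymm (affineSpan_subset_hyperplane fun q hq => ?_) fun q hq => ?_
  · have hcα := hc α (hΨ hαC.1)
    refine le_antisymm (closure_le hcα (fun v hv => ?_) hq.1) (le_closure hcα (fun v hv => ?_) hq.2)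
    · have := (mem_floorCell_iff.1 hv α (hΨ hαC.1)).2
      push_cast
      exact this.le
    · have := (mem_floorCell_iff.1 hv α (hΨ hαC.1)).1
      rw [hfα] at this
      exact this.le
  · have hqα : α q = ⌊α x⌋ + 1 := by
      have : α q = ((⌊α x⌋ + 1 : ℤ) : ℝ) := hq
      rw [this]; push_cast; ring
    -- The span is the whole hyperplane: a small step from `p` towards an arbitrary `q` in it stays
    -- in both closures, and `q` is recovered on the line through these two points at parameter
    -- `s⁻¹`.
    obtain ⟨s, hs, hsβ⟩ : ∃ s : ℝ, 0 < s ∧ ∀ β ∈ Ψ, β ≠ α →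
        (⌊β x⌋ : ℝ) < β (p + s • (q - p)) ∧ β (p + s • (q - p)) < ⌊β x⌋ + 1 := by
      have hev : ∀ β ∈ Ψ, ∀ᶠ s : ℝ in nhdsWithin 0 (Set.Ioi 0), β ≠ α →
          (⌊β x⌋ : ℝ) < β (p + s • (q - p)) ∧ β (p + s • (q - p)) < ⌊β x⌋ + 1 := by
        intro β hβ
        by_cases hne : β = α
        · exact Filter.Eventually.of_forall fun _ h => absurd hne h
        have hlim : Filter.Tendsto (fun s : ℝ => β (p + s • (q - p))) (nhdsWithin 0 (Set.Ioi 0))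
            (nhds (β p)) := by
          have := ((hc β (hΨ hβ)).comp (hseg q p)).tendsto 0
          simp only [Function.comp, zero_smul, add_zero] at this
          exact this.mono_left nhdsWithin_le_nhds
        obtain ⟨h1, h2⟩ := hpβ β hβ hne
        filter_upwards [hlim.eventually_lt_const h2, hlim.eventually_const_lt h1] with ε h3 h4
        exact fun _ => ⟨h4, h3⟩
      have hall := (Filter.eventually_all_finite hΨfin).2 hev
      obtain ⟨ε, h1, h2⟩ := (hall.and self_mem_nhdsWithin).exists
      exact ⟨ε, h2, h1⟩
    have hp1 := hclos p hpα hpβ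
    have hp2 := hclos (p + s • (q - p)) (by simp [hqα, hpα]) hsβ
    have := AffineMap.lineMap_mem s⁻¹ (subset_affineSpan ℝ _ hp1) (subset_affineSpan ℝ _ hp2)
    rw [AffineMap.lineMap_apply] at this
    simpa [smul_smul, hs.ne'] using this

/-- The acute cone of `A` in direction `w` consists of the alcoves `A'` such that no root of
`w(Φ⁺)` has a smaller integer part on `A'` than on `A`. -/
theorem mem_acuteCone_iff {Φ Δ : Set (Module.Dual ℝ E)} {w : E ≃ₗ[ℝ] E} (hΦ : Φ.Finite)
    (hc : ∀ α ∈ Φ, Continuous α) (h0 : ∀ α ∈ Φ, α ≠ 0)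
    (hΨ : movedPositiveRoots Φ Δ w ⊆ Φ)
    (hΦΨ : ∀ α ∈ Φ, α ∈ movedPositiveRoots Φ Δ w ∨ -α ∈ movedPositiveRoots Φ Δ w)
    (hprop : ∀ α ∈ movedPositiveRoots Φ Δ w, ∀ β ∈ movedPositiveRoots Φ Δ w,
      ∀ c : ℝ, β = c • α → β = α)
    {x y : E} (hx : x ∈ regularSet Φ) (hy : y ∈ regularSet Φ) :
    floorCell Φ y ∈ acuteCone Φ Δ (floorCell Φ x) w ↔
      ∀ α ∈ movedPositiveRoots Φ Δ w, ⌊α x⌋ ≤ ⌊α y⌋ := by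
  set Ψ := movedPositiveRoots Φ Δ w with hΨdef
  constructor
  · rintro ⟨l, g, ⟨hg1, hg2⟩, hdir, hgx, hgy⟩ α hα
    have key : ∀ n ≤ l, ∀ u ∈ g n, ⌊α x⌋ ≤ ⌊α u⌋ := by
      intro n
      induction n with
      | zero =>
        intro _ u hu
        rw [hgx] at hu
        exact (hu.2 α (hΨ hα)).ge
      | succ n ih =>
        intro hn u hu
        obtain ⟨v, hv⟩ := (hg1 n (by omega)).nonempty
        refine (ih (by omega) v hv).trans ?_
        obtain ⟨β, k, hβ, hsw⟩ : ∃ β, ∃ k : ℤ, β ∈ Ψ ∧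
            ShareWall (g n) (g (n + 1)) (hyperplane β k) := by
          obtain ⟨β, hβ, k, hsw⟩ := hg2 n (by omega)
          rcases hΦΨ β hβ with h | h
          · exact ⟨β, k, h, hsw⟩
          · refine ⟨-β, -k, h, ?_⟩
            have : hyperplane (-β) (-k) = hyperplane β k := by
              ext u
              simp [hyperplane]
            rwa [this]
        obtain ⟨hneg, hpos⟩ := hdir n (by omega) β hβ k hsw
        exact floor_le_of_shareWall hc h0 hΨ hprop (hg1 n (by omega)) (hg1 (n + 1) hn) hβ hsw
          hneg hpos hα hv hu
    exact key l le_rfl y (by rw [hgy]; exact self_mem_floorCell hy)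
  · have hΨfin : Ψ.Finite := hΦ.subset hΨ
    intro hle
    -- Induction on the total deficit of integer parts, which falls by exactly one with each wall
    -- crossed.
    obtain ⟨N, hN⟩ : ∃ N : ℕ, ∑ α ∈ hΨfin.toFinset, (⌊α y⌋ - ⌊α x⌋) = N := by
      refine ⟨_, (Int.toNat_of_nonneg (Finset.sum_nonneg fun α hα => ?_)).symm⟩
      have := hle α (by simpa using hα)
      omega
    induction N generalizing x with
    | zero =>
      have hz := (Finset.sum_eq_zero_iff_of_nonneg (fun α hα => by
        have := hle α (by simpa using hα)
        omega)).1 hN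
      have heq : floorCell Φ y = floorCell Φ x := by
        refine floorCell_eq_of_mem ⟨hy, fun α hα => ?_⟩
        rcases hΦΨ α hα with h | h
        · have := hz α (by simpa using h)
          omega
        · have := hz (-α) (by simpa using h)
          have hneg : ∀ u ∈ regularSet Φ, ⌊(-α) u⌋ = -⌊α u⌋ - 1 := by
            intro u hu
            have h2 := mem_floorCell_iff.1 (self_mem_floorCell hu) α hα
            rw [Int.floor_eq_iff]
            simp only [LinearMap.neg_apply]
            push_cast
            constructor <;> linarith [h2.1, h2.2]
          rw [hneg x hx, hneg y hy] at this
          omega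
      refine ⟨0, fun _ => floorCell Φ x, ⟨fun i _ => isAlcove_floorCell hc hx,
        fun i hi => absurd hi (by omega)⟩, fun i hi => absurd hi (by omega), rfl, heq.symm⟩
    | succ N ih =>
      obtain ⟨γ, hγ, hlt⟩ : ∃ γ ∈ Ψ, ⌊γ x⌋ < ⌊γ y⌋ := by
        by_contra! hcon
        have : ∑ α ∈ hΨfin.toFinset, (⌊α y⌋ - ⌊α x⌋) ≤ 0 := Finset.sum_nonpos fun α hα => by
          have := hcon α (by simpa using hα)
          omega
        rw [hN] at this
        omega
      obtain ⟨α, hα, z, hz, h1, h2, h3, hsw⟩ :=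
        exists_adjacent hΦ hc hΨ hΦΨ hprop hx hy hle hγ hlt
      have hle' : ∀ β ∈ Ψ, ⌊β z⌋ ≤ ⌊β y⌋ := by
        intro β hβ
        by_cases hne : β = α
        · rw [hne]; exact h2
        · rw [h3 β hβ hne]; exact hle β hβ
      have hN' : ∑ β ∈ hΨfin.toFinset, (⌊β y⌋ - ⌊β z⌋) = N := by
        have hsum : ∑ β ∈ hΨfin.toFinset, (⌊β z⌋ - ⌊β x⌋) = 1 := by
          rw [Finset.sum_eq_single_of_mem α (by simpa using hα)]
          · omega
          · intro β hβ hne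
            rw [h3 β (by simpa using hβ) hne, sub_self]
        have : ∑ β ∈ hΨfin.toFinset, (⌊β y⌋ - ⌊β z⌋) = ∑ β ∈ hΨfin.toFinset, (⌊β y⌋ - ⌊β x⌋) -
            ∑ β ∈ hΨfin.toFinset, (⌊β z⌋ - ⌊β x⌋) := by
          rw [← Finset.sum_sub_distrib]
          exact Finset.sum_congr rfl fun β _ => by ring
        rw [this, hN, hsum]
        push_cast
        ring
      obtain ⟨l, g, ⟨hg1, hg2⟩, hdir, hg0, hgl⟩ := ih hz hle' hN'
      refine ⟨l + 1, fun n => Nat.casesOn n (floorCell Φ x) g, ⟨?_, ?_⟩, ?_, rfl, hgl⟩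
      · rintro (_ | i) hi
        · exact isAlcove_floorCell hc hx
        · exact hg1 i (by omega)
      · rintro (_ | i) hi
        · exact ⟨α, hΨ hα, ⌊α z⌋, by simpa [hg0] using hsw⟩
        · exact hg2 i (by omega)
      · rintro (_ | i) hi
        · intro β hβ k hk
          simp only [hg0] at hk ⊢
          -- The direction condition concerns every way of writing the wall as `H_{β,k}` with `β ∈
          -- Ψ`; there is only one, since proportional elements of `Ψ` coincide.
          have hHH : hyperplane α ⌊α z⌋ = hyperplane β k := hsw.symm.trans hk
          obtain ⟨c, hcc⟩ := exists_smul_of_hyperplane_subset (h0 α (hΨ hα)) hHH.subset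
          obtain rfl := hprop α hα β hβ c hcc
          obtain ⟨q, hq⟩ := hyperplane_nonempty (h0 β (hΨ hα)) k
          have hk1 : β q = k := hq
          have hk2 : β q = ⌊β z⌋ := by rw [← hHH] at hq; exact hq
          have hk3 : ⌊β z⌋ = k := by exact_mod_cast hk2.symm.trans hk1
          subst hk3
          constructor
          · intro u hu
            have := (mem_floorCell_iff.1 hu β (hΨ hα)).2
            rw [h1]
            simpa [negHalfSpace] using this
          · intro u hu
            exact (mem_floorCell_iff.1 hu β (hΨ hα)).1
        · exact hdir i (by omega)

end Cones

/-! ### Roots as functionals on `V` -/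

section RootFunctionals

variable {ι M N : Type*} [AddCommGroup M] [AddCommGroup N]

/-- A weight as a linear functional on `V`. -/
def weightFun (P : RootDatum ι M N) : M →ₗ[ℤ] Module.Dual ℝ (CoweightSpace N) :=
  Module.Dual.baseChange (R := ℤ) (V := N) ℝ ∘ₗ P.toLinearMap

lemma weightFun_tmul (P : RootDatum ι M N) (m : M) (r : ℝ) (n : N) :
    weightFun P m (r ⊗ₜ n) = P.toLinearMap m n * r := by
  simp [weightFun, mul_comm]

lemma weightFun_root (P : RootDatum ι M N) (i : ι) : weightFun P (P.root i) = rootFun P i := rfl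

lemma rootFun_tmul (P : RootDatum ι M N) (i : ι) (r : ℝ) (n : N) :
    rootFun P i (r ⊗ₜ n) = P.toLinearMap (P.root i) n * r :=
  weightFun_tmul P _ r n

lemma weightFun_injective (P : RootDatum ι M N) : Function.Injective (weightFun P) := by
  intro m m' h
  have : P.toLinearMap m = P.toLinearMap m' := by
    ext n
    have := LinearMap.congr_fun h ((1 : ℝ) ⊗ₜ n)
    simpa [weightFun_tmul] using this
  exact P.toPerfPair.injective this

lemma rootFun_injective (P : RootDatum ι M N) : Function.Injective (rootFun P) :=
  (weightFun_injective P).comp P.root.injective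

/-- A coroot as an element of `V`. -/
def corootV (P : RootDatum ι M N) (i : ι) : CoweightSpace N := (1 : ℝ) ⊗ₜ[ℤ] P.coroot i

lemma rootFun_corootV (P : RootDatum ι M N) (i j : ι) :
    rootFun P i (corootV P j) = P.pairing i j := by
  simp [corootV, rootFun_tmul]

lemma rootFun_ne_zero (P : RootDatum ι M N) (i : ι) : rootFun P i ≠ 0 := by
  intro h
  have := rootFun_corootV P i i
  simp [h] at this

lemma rootFun_reflectionPerm (P : RootDatum ι M N) (i j : ι) :
    rootFun P (P.reflectionPerm j i) = rootFun P i - (P.pairing i j : ℝ) • rootFun P j := by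
  simp only [← weightFun_root, ← P.reflectionPerm_root, map_sub, map_zsmul]
  simp [← Int.cast_smul_eq_zsmul ℝ]

lemma rootFun_neg (P : RootDatum ι M N) (i : ι) :
    rootFun P (P.reflectionPerm i i) = -rootFun P i := by
  rw [rootFun_reflectionPerm]
  simp [two_smul]

lemma rootFun_reflectionV (P : RootDatum ι M N) (i j : ι) (x : CoweightSpace N) :
    rootFun P (P.reflectionPerm j i) (reflectionV P j x) = rootFun P i x := by
  induction x using TensorProduct.induction_on with
  | zero => simp
  | add x y hx hy => simp only [map_add, hx, hy]
  | tmul r n =>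
    have h1 : reflectionV P j (r ⊗ₜ n) = r ⊗ₜ P.coreflection j n := rfl
    rw [h1, rootFun_tmul, rootFun_tmul, ← P.reflectionPerm_root, P.coreflection_apply]
    congr 2
    simp
    ring

/-- `autN` inverts the contravariant coweight map, and the weight and coweight maps are transposes
of each other. -/
lemma rootFun_aut (P : RootDatum ι M N) (Θ : P.Aut) (i : ι) (x : CoweightSpace N) :
    rootFun P (Θ.indexEquiv i) (autV P Θ x) = rootFun P i x := by
  induction x using TensorProduct.induction_on with
  | zero => simp
  | add x y hx hy => simp only [map_add, hx, hy]
  | tmul r n =>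
    have h1 : autV P Θ (r ⊗ₜ n) = r ⊗ₜ autN P Θ n := rfl
    rw [h1, rootFun_tmul, rootFun_tmul]
    obtain ⟨n', rfl⟩ := (RootPairing.Equiv.coweightEquiv P P Θ).surjective n
    have h2 : autN P Θ (RootPairing.Equiv.coweightEquiv P P Θ n') = n' := by simp [autN]
    rw [h2, ← RootPairing.Hom.root_weightMap_apply]
    have h3 := LinearMap.congr_fun
      (RootPairing.Hom.weight_coweight_transpose_apply P P n' Θ.toHom) (P.root i)
    simp at h3
    rw [h3]
    rfl

lemma autV_corootV (P : RootDatum ι M N) (Θ : P.Aut) (i : ι) :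
    autV P Θ (corootV P i) = corootV P (Θ.indexEquiv i) := by
  have h1 : autV P Θ (corootV P i) = 1 ⊗ₜ autN P Θ (P.coroot i) := rfl
  rw [h1, corootV]
  congr 1
  rw [autN, LinearEquiv.symm_apply_eq, RootPairing.Equiv.coweightEquiv_apply,
    RootPairing.Hom.coroot_coweightMap_apply]
  simp

lemma pairing_aut (P : RootDatum ι M N) (Θ : P.Aut) (i j : ι) :
    P.pairing (Θ.indexEquiv i) (Θ.indexEquiv j) = P.pairing i j := by
  have := rootFun_aut P Θ i (corootV P j)
  rw [autV_corootV, rootFun_corootV, rootFun_corootV] at this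
  exact_mod_cast this

lemma continuous_dual [Module.Finite ℤ N] (f : Module.Dual ℝ (CoweightSpace N)) :
    Continuous f :=
  have : IsModuleTopology ℝ (CoweightSpace N) := ⟨rfl⟩
  IsModuleTopology.continuous_of_linearMap f

instance : ContinuousAdd (CoweightSpace N) :=
  have : IsModuleTopology ℝ (CoweightSpace N) := ⟨rfl⟩
  IsModuleTopology.toContinuousAdd ℝ _

instance : ContinuousSMul ℝ (CoweightSpace N) :=
  have : IsModuleTopology ℝ (CoweightSpace N) := ⟨rfl⟩
  IsModuleTopology.toContinuousSMul ℝ _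

/-- The lattice `X_*^{[Θ]}` is the kernel of a map to `ℤ^ι`, and `ℝ` is flat over `ℤ`, so extending
scalars commutes with taking this kernel. -/
lemma mem_foldedSpace [Finite ι] (P : RootDatum ι M N) (Θ : P.Aut) {x : CoweightSpace N} :
    x ∈ foldedSpace P Θ ↔ ∀ i, rootFun P i (autV P Θ x) = rootFun P i x := by
  cases nonempty_fintype ι
  classical
  let f : N →ₗ[ℤ] (ι → ℤ) :=
    LinearMap.pi fun i => P.root' i ∘ₗ (LinearMap.id - (autN P Θ : N →ₗ[ℤ] N))
  have hker : foldedLattice P Θ = LinearMap.ker f := by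
    rw [foldedLattice, LinearMap.ker_pi]
  have h1 : foldedSpace P Θ = LinearMap.ker (LinearMap.baseChange ℝ f) := by
    rw [foldedSpace, hker]
    exact (Module.Flat.ker_lTensor_eq ℝ ℝ f).symm
  have hinj : Function.Injective (fun (y : ℝ ⊗[ℤ] (ι → ℤ)) i =>
      TensorProduct.rid ℤ ℝ (LinearMap.lTensor ℝ (LinearMap.proj i : (ι → ℤ) →ₗ[ℤ] ℤ) y)) := by
    have : (fun (y : ℝ ⊗[ℤ] (ι → ℤ)) i =>
      TensorProduct.rid ℤ ℝ (LinearMap.lTensor ℝ (LinearMap.proj i : (ι → ℤ) →ₗ[ℤ] ℤ) y)) =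
        TensorProduct.piScalarRight ℤ ℝ ℝ ι := by
      ext y i
      induction y with
      | zero => simp
      | add x y hx hy => simp_all
      | tmul r n => simp
    rw [this]
    exact LinearEquiv.injective _
  have key : ∀ i, TensorProduct.rid ℤ ℝ (LinearMap.lTensor ℝ (LinearMap.proj i : (ι → ℤ) →ₗ[ℤ] ℤ)
      (LinearMap.baseChange ℝ f x)) = rootFun P i x - rootFun P i (autV P Θ x) := by
    intro i
    induction x using TensorProduct.induction_on with
    | zero => simp
    | add x y hx hy =>
      simp only [map_add, hx, hy]
      ring
    | tmul r n =>
      have h1 : autV P Θ (r ⊗ₜ n) = r ⊗ₜ autN P Θ n := rfl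
      rw [h1, rootFun_tmul, rootFun_tmul]
      simp [f]
      ring
  rw [h1, LinearMap.mem_ker]
  constructor
  · intro h i
    have := key i
    rw [h] at this
    simp at this
    linarith
  · intro h
    apply hinj
    ext i
    simp only [key i, h i, sub_self, map_zero]

/-- Flatness preserves the independence of the simple roots in `ℝ ⊗ M`. In the basis dual to the
basis `e` of `N`, their coordinates are the values of the functionals at `1 ⊗ e k`. -/
lemma linearIndependent_rootFun [Module.Finite ℤ N] (P : RootDatum ι M N) (b : P.Base) :
    LinearIndependent ℝ fun i : b.support => rootFun P i := by
  have hN : Module.IsReflexive ℤ N := .of_isPerfPair P.flip.toLinearMap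
  have : Module.Free ℤ N := inferInstance
  let e := Module.Free.chooseBasis ℤ N
  let B := e.dualBasis.map P.toPerfPair.symm
  have hli := Module.Flat.linearIndependent_one_tmul (S := ℝ) b.linearIndepOn_root
  rw [Fintype.linearIndependent_iff] at hli ⊢
  intro g hg
  refine hli g ?_
  apply (B.baseChange ℝ).repr.injective
  ext k
  have h1 := LinearMap.congr_fun hg ((1 : ℝ) ⊗ₜ e k)
  simp only [LinearMap.coe_sum, Finset.sum_apply, LinearMap.smul_apply, rootFun_tmul,
    LinearMap.zero_apply] at h1
  simp only [map_sum, map_smul, Finsupp.coe_finsetSum, Finset.sum_apply, Finsupp.smul_apply,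
    Module.Basis.baseChange_repr_tmul, map_zero, Finsupp.zero_apply]
  rw [← h1]
  refine Finset.sum_congr rfl fun i _ => ?_
  simp [B]

/-- Fundamental coweights. -/
lemma exists_fundamentalCoweights [Module.Finite ℤ N] (P : RootDatum ι M N) (b : P.Base) :
    ∃ ω : ι → CoweightSpace N, ∀ i ∈ b.support, ∀ j ∈ b.support,
      (i = j → rootFun P j (ω i) = 1) ∧ (i ≠ j → rootFun P j (ω i) = 0) := by
  classical
  have hli := linearIndependent_rootFun P b
  let F : CoweightSpace N →ₗ[ℝ] (b.support → ℝ) := LinearMap.pi fun i => rootFun P i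
  have hli' : LinearIndependent ℝ fun (i : b.support) (x : CoweightSpace N) => rootFun P i x := by
    rw [Fintype.linearIndependent_iff] at hli ⊢
    intro g hg
    refine hli g (LinearMap.ext fun x => ?_)
    simpa using congrFun hg x
  have hsurj : Function.Surjective F := by
    rw [← LinearMap.range_eq_top, ← span_flip_eq_top_iff_linearIndependent.2 hli']
    have : Set.range (flip fun (i : b.support) (x : CoweightSpace N) => rootFun P i x) =
        (LinearMap.range F : Set (b.support → ℝ)) := rfl
    rw [this, Submodule.span_eq]
  choose G hG using hsurj
  refine ⟨fun i => if hi : i ∈ b.support then G (Pi.single ⟨i, hi⟩ 1) else 0, fun i hi j hj => ?_⟩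
  have := congrFun (hG (Pi.single ⟨i, hi⟩ 1)) ⟨j, hj⟩
  simp only [F, LinearMap.pi_apply] at this
  simp only [hi, dif_pos, this]
  constructor
  · rintro rfl; simp
  · intro h
    rw [Pi.single_eq_of_ne]
    simpa using fun h' => h h'.symm

end RootFunctionals

/-! ### Orbits and averages -/

section Orbits

variable {ι M N : Type*} [AddCommGroup M] [AddCommGroup N] (P : RootDatum ι M N) (Θ : P.Aut)

lemma self_mem_orbit (i : ι) : i ∈ orbit P Θ i := Equiv.Perm.SameCycle.refl _ i

lemma aut_mem_orbit_iff {i j : ι} : Θ.indexEquiv j ∈ orbit P Θ i ↔ j ∈ orbit P Θ i :=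
  Equiv.Perm.sameCycle_apply_right

variable {P Θ} in
lemma eq_of_mem_orbit {α : Type*} {f : ι → α} (hf : ∀ i, f (Θ.indexEquiv i) = f i) {i j : ι}
    (hj : j ∈ orbit P Θ i) : f j = f i := by
  obtain ⟨n, rfl⟩ := hj
  have hinv : ∀ i, f ((Θ.indexEquiv : Equiv.Perm ι)⁻¹ i) = f i := fun i => by
    rw [← hf]
    exact congrArg f (Equiv.apply_symm_apply Θ.indexEquiv i)
  induction n with
  | zero => simp
  | succ n ih =>
    rw [add_comm, zpow_add, zpow_one, Equiv.Perm.mul_apply]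
    exact (hf _).trans ih
  | pred n ih =>
    rw [sub_eq_add_neg, add_comm, zpow_add, zpow_neg_one, Equiv.Perm.mul_apply, hinv, ih]

lemma orbit_eq_of_mem {i j : ι} (hj : j ∈ orbit P Θ i) : orbit P Θ j = orbit P Θ i := by
  ext k
  exact ⟨fun h => Equiv.Perm.SameCycle.trans hj h, fun h => Equiv.Perm.SameCycle.trans hj.symm h⟩

variable [Finite ι]

/-- The averaging operator of `Θ`, a projection of `V` to the folded space up to the radical. -/
def averageV : CoweightSpace N →ₗ[ℝ] CoweightSpace N :=
  (orderOf (Θ.indexEquiv : Equiv.Perm ι) : ℝ)⁻¹ •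
    ∑ k ∈ Finset.range (orderOf (Θ.indexEquiv : Equiv.Perm ι)),
      ((autV P Θ : CoweightSpace N →ₗ[ℝ] CoweightSpace N) ^ k)

lemma orderOf_indexEquiv_pos : 0 < orderOf (Θ.indexEquiv : Equiv.Perm ι) := orderOf_pos _

omit [Finite ι] in
lemma averageV_apply (x : CoweightSpace N) (f : Module.Dual ℝ (CoweightSpace N)) :
    f (averageV P Θ x) = (orderOf (Θ.indexEquiv : Equiv.Perm ι) : ℝ)⁻¹ *
      ∑ k ∈ Finset.range (orderOf (Θ.indexEquiv : Equiv.Perm ι)),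
        f (((autV P Θ : CoweightSpace N →ₗ[ℝ] CoweightSpace N) ^ k) x) := by
  simp [averageV]

omit [Finite ι] in
lemma rootFun_autV (i : ι) (x : CoweightSpace N) :
    rootFun P i (autV P Θ x) = rootFun P ((Θ.indexEquiv : Equiv.Perm ι)⁻¹ i) x := by
  have h := rootFun_aut P Θ ((Θ.indexEquiv : Equiv.Perm ι)⁻¹ i) x
  rwa [show Θ.indexEquiv ((Θ.indexEquiv : Equiv.Perm ι)⁻¹ i) = i from
    Equiv.apply_symm_apply Θ.indexEquiv i] at h

omit [Finite ι] in
lemma rootFun_autV_pow (k : ℕ) (i : ι) (x : CoweightSpace N) :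
    rootFun P i (((autV P Θ : CoweightSpace N →ₗ[ℝ] CoweightSpace N) ^ k) x) =
      rootFun P (((Θ.indexEquiv : Equiv.Perm ι)⁻¹ ^ k) i) x := by
  induction k generalizing i with
  | zero => simp
  | succ k ih =>
    rw [pow_succ', pow_succ, Module.End.mul_apply, Equiv.Perm.mul_apply, ← ih]
    exact rootFun_autV P Θ i _

/-- The average runs over the order of the permutation of the roots. `Θ` may have larger or infinite
order on `V`, but the folded space only asks that roots agree at a point and at its image. -/
lemma averageV_mem (x : CoweightSpace N) : averageV P Θ x ∈ foldedSpace P Θ := by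
  rw [mem_foldedSpace]
  intro i
  rw [rootFun_autV, averageV_apply, averageV_apply]
  congr 1
  simp_rw [rootFun_autV_pow]
  set σ := (Θ.indexEquiv : Equiv.Perm ι)
  have h1 := Finset.sum_range_succ (fun k => rootFun P ((σ⁻¹ ^ k) i) x) (orderOf σ)
  rw [Finset.sum_range_succ'] at h1
  have h2 : σ⁻¹ ^ orderOf σ = 1 := by rw [← orderOf_inv, pow_orderOf_eq_one]
  rw [h2] at h1
  simp only [pow_zero, Equiv.Perm.one_apply, add_left_inj] at h1
  rw [← h1]
  exact Finset.sum_congr rfl fun k _ => by rw [pow_succ, Equiv.Perm.mul_apply]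

lemma averageV_apply_of_invariant {f : Module.Dual ℝ (CoweightSpace N)}
    (hf : ∀ x, f (autV P Θ x) = f x) (x : CoweightSpace N) : f (averageV P Θ x) = f x := by
  have h : ∀ k, f (((autV P Θ : CoweightSpace N →ₗ[ℝ] CoweightSpace N) ^ k) x) = f x := by
    intro k
    induction k with
    | zero => simp
    | succ k ih =>
      rw [pow_succ', Module.End.mul_apply, ← ih]
      exact hf _
  have := orderOf_indexEquiv_pos P Θ
  rw [averageV_apply]
  simp only [h, Finset.sum_const, Finset.card_range, nsmul_eq_mul]
  field_simp

variable {P Θ} in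
lemma rootFun_aut_of_mem {x : CoweightSpace N} (hx : x ∈ foldedSpace P Θ) (i : ι) :
    rootFun P (Θ.indexEquiv i) x = rootFun P i x := by
  rw [← (mem_foldedSpace P Θ).1 hx (Θ.indexEquiv i), rootFun_aut]

variable {P Θ} in
lemma rootFun_eq_of_mem_orbit {x : CoweightSpace N} (hx : x ∈ foldedSpace P Θ) {i j : ι}
    (hj : j ∈ orbit P Θ i) : rootFun P j x = rootFun P i x :=
  eq_of_mem_orbit (f := fun i => rootFun P i x) (rootFun_aut_of_mem hx) hj

/-- The orbit of a root, as a finset. -/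
def orbitFinset (i : ι) : Finset ι := (Set.toFinite (orbit P Θ i)).toFinset

@[simp] lemma mem_orbitFinset {i j : ι} : j ∈ orbitFinset P Θ i ↔ j ∈ orbit P Θ i := by
  simp [orbitFinset]

lemma sum_orbitFinset_aut {A : Type*} [AddCommMonoid A] (i : ι) (f : ι → A) :
    ∑ j ∈ orbitFinset P Θ i, f (Θ.indexEquiv j) = ∑ j ∈ orbitFinset P Θ i, f j :=
  Finset.sum_equiv Θ.indexEquiv (fun j => by simp [aut_mem_orbit_iff]) fun _ _ => rfl

lemma orbitAverage_eq (i : ι) : orbitAverage P Θ i =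
    ((orbitFinset P Θ i).card : ℝ)⁻¹ • ∑ j ∈ orbitFinset P Θ i, rootFun P j := by
  rw [orbitAverage, orbitFinset, ← finsum_mem_eq_finite_toFinset_sum,
    Set.ncard_eq_toFinset_card _ (Set.toFinite _)]

lemma orbitFinset_card_pos (i : ι) : 0 < (orbitFinset P Θ i).card :=
  Finset.card_pos.2 ⟨i, by simpa using self_mem_orbit P Θ i⟩

lemma orbitAverage_autV (i : ι) (x : CoweightSpace N) :
    orbitAverage P Θ i (autV P Θ x) = orbitAverage P Θ i x := by
  simp only [orbitAverage_eq, LinearMap.smul_apply, LinearMap.coe_sum, Finset.sum_apply]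
  congr 1
  rw [← sum_orbitFinset_aut]
  simp only [rootFun_aut]

lemma orbitAverage_apply_of_mem (i : ι) {x : CoweightSpace N} (hx : x ∈ foldedSpace P Θ) :
    orbitAverage P Θ i x = rootFun P i x := by
  have := orbitFinset_card_pos P Θ i
  simp only [orbitAverage_eq, LinearMap.smul_apply, LinearMap.coe_sum, Finset.sum_apply]
  rw [Finset.sum_congr rfl fun j hj =>
    rootFun_eq_of_mem_orbit hx ((mem_orbitFinset P Θ).1 hj)]
  simp only [Finset.sum_const, nsmul_eq_mul, smul_eq_mul]
  field_simp

/-- The restriction of a root to the folded space. -/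
def restrictedRoot (i : ι) : Module.Dual ℝ (foldedSpace P Θ) := restrictFun P Θ (rootFun P i)

omit [Finite ι] in
@[simp] lemma restrictedRoot_apply (i : ι) (x : foldedSpace P Θ) :
    restrictedRoot P Θ i x = rootFun P i x := rfl

lemma restrictFun_orbitAverage (i : ι) :
    restrictFun P Θ (orbitAverage P Θ i) = restrictedRoot P Θ i := by
  ext x
  exact orbitAverage_apply_of_mem P Θ i x.2

lemma restrictedRoot_eq_of_mem_orbit {i j : ι} (hj : j ∈ orbit P Θ i) :
    restrictedRoot P Θ j = restrictedRoot P Θ i := by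
  ext x
  exact rootFun_eq_of_mem_orbit x.2 hj

/-- An orbit average is `Θ`-invariant, so its value at `x` equals its value at `averageV P Θ x`, a
point of the folded space. Discarding smaller multiples thus means the same before and after
restriction. -/
lemma orbitAverage_eq_smul_iff {i j : ι} {c : ℝ} :
    orbitAverage P Θ i = c • orbitAverage P Θ j ↔
      restrictedRoot P Θ i = c • restrictedRoot P Θ j := by
  constructor
  · intro h
    rw [← restrictFun_orbitAverage, ← restrictFun_orbitAverage, h]
    rfl
  · intro h
    refine LinearMap.ext fun x => ?_
    rw [LinearMap.smul_apply, ← averageV_apply_of_invariant P Θ (orbitAverage_autV P Θ i),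
      ← averageV_apply_of_invariant P Θ (orbitAverage_autV P Θ j),
      orbitAverage_apply_of_mem P Θ _ (averageV_mem P Θ x),
      orbitAverage_apply_of_mem P Θ _ (averageV_mem P Θ x)]
    exact LinearMap.congr_fun h ⟨_, averageV_mem P Θ x⟩

/-- A root is long if its restriction to the folded space is not a smaller multiple of the
restriction of another root. -/
def IsLong (i : ι) : Prop :=
  ∀ (j : ι) (c : ℝ), 0 < c → c < 1 → restrictedRoot P Θ i ≠ c • restrictedRoot P Θ j

lemma mem_foldedRoots {f : Module.Dual ℝ (foldedSpace P Θ)} :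
    f ∈ foldedRoots P Θ ↔ ∃ i, IsLong P Θ i ∧ f = restrictedRoot P Θ i := by
  constructor
  · rintro ⟨-, ⟨⟨i, rfl⟩, h⟩, rfl⟩
    refine ⟨i, fun j c h0 h1 hc => h ⟨j, c, h0, h1, ?_⟩, restrictFun_orbitAverage P Θ i⟩
    exact (orbitAverage_eq_smul_iff P Θ).2 hc
  · rintro ⟨i, hi, rfl⟩
    refine ⟨orbitAverage P Θ i, ⟨⟨i, rfl⟩, ?_⟩, restrictFun_orbitAverage P Θ i⟩
    rintro ⟨j, c, h0, h1, hc⟩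
    exact hi j c h0 h1 ((orbitAverage_eq_smul_iff P Θ).1 hc)

lemma foldedRoots_finite : (foldedRoots P Θ).Finite :=
  (Set.finite_range (restrictedRoot P Θ)).subset fun f hf => by
    obtain ⟨i, -, rfl⟩ := (mem_foldedRoots P Θ).1 hf
    exact ⟨i, rfl⟩

/-- The sum of the coroots in the orbit of a root. -/
def corootSum (i : ι) : CoweightSpace N := ∑ j ∈ orbitFinset P Θ i, corootV P j

lemma rootFun_corootSum (k i : ι) :
    rootFun P k (corootSum P Θ i) = ((∑ j ∈ orbitFinset P Θ i, P.pairing k j : ℤ) : ℝ) := by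
  simp [corootSum, rootFun_corootV]

lemma corootSum_mem (i : ι) : corootSum P Θ i ∈ foldedSpace P Θ := by
  rw [mem_foldedSpace]
  intro k
  have : autV P Θ (corootSum P Θ i) = corootSum P Θ i := by
    rw [corootSum, map_sum]
    simp only [autV_corootV]
    exact sum_orbitFinset_aut P Θ i (corootV P)
  rw [this]

end Orbits

/-! ### Heights and restricted roots -/

section Heights

variable {ι M N : Type*} [Finite ι] [AddCommGroup M] [AddCommGroup N] [Module.Finite ℤ N]
  {P : RootDatum ι M N} (b : P.Base) (Θ : P.Aut)

omit [Finite ι] [Module.Finite ℤ N] in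
lemma aut_pow_mem_support {Θ : P.Aut} (hΘ : ∀ i, i ∈ b.support → Θ.indexEquiv i ∈ b.support)
    {i : ι} (hi : i ∈ b.support) (n : ℕ) : ((Θ.indexEquiv : Equiv.Perm ι) ^ n) i ∈ b.support := by
  induction n with
  | zero => simpa
  | succ n ih =>
    rw [pow_succ', Equiv.Perm.mul_apply]
    exact hΘ _ ih

variable {b Θ} in
omit [Module.Finite ℤ N] in
lemma mem_support_of_mem_orbit (hΘ : ∀ i, i ∈ b.support → Θ.indexEquiv i ∈ b.support)
    {i j : ι} (hi : i ∈ b.support) (hj : j ∈ orbit P Θ i) : j ∈ b.support := by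
  obtain ⟨n, -, rfl⟩ := Equiv.Perm.SameCycle.exists_pow_eq' hj
  exact aut_pow_mem_support b hΘ hi n

/-- The average of a fundamental coweight over its orbit. -/
lemma exists_foldedCoweights (hΘ : ∀ i, i ∈ b.support → Θ.indexEquiv i ∈ b.support) :
    ∃ ω : ι → CoweightSpace N, (∀ i, ω i ∈ foldedSpace P Θ) ∧
      ∀ i ∈ b.support, ∀ j ∈ b.support,
        (j ∈ orbit P Θ i → 0 < rootFun P j (ω i)) ∧ (j ∉ orbit P Θ i → rootFun P j (ω i) = 0) := by
  obtain ⟨ω, hω⟩ := exists_fundamentalCoweights P b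
  have hpos := orderOf_indexEquiv_pos P Θ
  have hterm : ∀ i ∈ b.support, ∀ j ∈ b.support, 0 ≤ rootFun P j (ω i) := by
    intro i hi j hj
    by_cases h : i = j
    · rw [(hω i hi j hj).1 h]; exact zero_le_one
    · rw [(hω i hi j hj).2 h]
  have hsupp : ∀ j ∈ b.support, ∀ k, ((Θ.indexEquiv : Equiv.Perm ι)⁻¹ ^ k) j ∈ b.support := by
    intro j hj k
    refine mem_support_of_mem_orbit hΘ hj ⟨-k, ?_⟩
    simp
  have hmem : ∀ i ∈ b.support, ∀ j ∈ b.support, j ∈ orbit P Θ i →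
      0 < rootFun P j (averageV P Θ (ω i)) := by
    intro i hi j hj hij
    have h1 : i ∈ orbit P Θ j := Equiv.Perm.SameCycle.symm hij
    rw [← rootFun_eq_of_mem_orbit (averageV_mem P Θ _) h1, averageV_apply]
    simp_rw [rootFun_autV_pow]
    refine mul_pos (by positivity) (Finset.sum_pos' (fun k _ => hterm i hi _ (hsupp i hi k))
      ⟨0, by simpa using hpos, ?_⟩)
    simp [(hω i hi i hi).1 rfl]
  refine ⟨fun i => averageV P Θ (ω i), fun i => averageV_mem P Θ _, fun i hi j hj =>
    ⟨hmem i hi j hj, fun hij => ?_⟩⟩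
  rw [averageV_apply]
  simp_rw [rootFun_autV_pow]
  rw [Finset.sum_eq_zero, mul_zero]
  intro k _
  refine (hω i hi _ (hsupp j hj k)).2 fun h => hij ?_
  have : orbit P Θ i = orbit P Θ j := orbit_eq_of_mem P Θ ⟨-k, by rw [h]; simp⟩
  rw [this]
  exact self_mem_orbit P Θ j

/-- A point of the folded space at which all simple roots are `1`. -/
lemma exists_foldedRho (hΘ : ∀ i, i ∈ b.support → Θ.indexEquiv i ∈ b.support) :
    ∃ ρ ∈ foldedSpace P Θ, ∀ i ∈ b.support, rootFun P i ρ = 1 := by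
  classical
  obtain ⟨ω, hω⟩ := exists_fundamentalCoweights P b
  have hpos := orderOf_indexEquiv_pos P Θ
  refine ⟨averageV P Θ (∑ i ∈ b.support, ω i), averageV_mem P Θ _, fun j hj => ?_⟩
  have h : ∀ j ∈ b.support, rootFun P j (∑ i ∈ b.support, ω i) = 1 := by
    intro j hj
    rw [map_sum, Finset.sum_eq_single_of_mem j hj, (hω j hj j hj).1 rfl]
    intro i hi hij
    exact (hω i hi j hj).2 hij
  rw [averageV_apply]
  simp_rw [rootFun_autV_pow]
  have hk : ∀ k, ((Θ.indexEquiv : Equiv.Perm ι)⁻¹ ^ k) j ∈ b.support := fun k =>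
    mem_support_of_mem_orbit hΘ hj ⟨-k, by simp⟩
  simp only [fun k => h _ (hk k)]
  simp only [Finset.sum_const, Finset.card_range, nsmul_eq_mul, mul_one]
  field_simp

omit [Finite ι] [Module.Finite ℤ N] in
lemma rootFun_eq_height {ρ : CoweightSpace N} (hρ : ∀ i ∈ b.support, rootFun P i ρ = 1) (i : ι) :
    rootFun P i ρ = b.height i := by
  obtain ⟨f, -, -, hf⟩ := b.exists_root_eq_sum_int i
  rw [RootPairing.Base.height_eq_sum hf, ← weightFun_root, hf, map_sum, LinearMap.coe_sum,
    Finset.sum_apply]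
  push_cast
  refine Finset.sum_congr rfl fun j hj => ?_
  rw [map_zsmul, weightFun_root, LinearMap.smul_apply, hρ j hj]
  simp

omit [Finite ι] [Module.Finite ℤ N] in
/-- A functional on weights that is nonnegative on simple roots is so on their sums. -/
lemma weightFun_nonneg {x : CoweightSpace N} {s : Set ι} (hx : ∀ i ∈ s, 0 ≤ rootFun P i x)
    {m : M} (hm : m ∈ AddSubmonoid.closure (P.root '' s)) : 0 ≤ weightFun P m x := by
  induction hm using AddSubmonoid.closure_induction with
  | mem y hy =>
    obtain ⟨i, hi, rfl⟩ := hy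
    exact hx i hi
  | zero => simp
  | add y z _ _ hy hz =>
    rw [map_add, LinearMap.add_apply]
    exact add_nonneg hy hz

omit [Finite ι] in
-- Evaluation at the sum of the fundamental coweights is the height, whose sign decides whether the
-- root or its negative is a sum of simple roots.
lemma isPos_iff_mem_closure {i : ι} :
    b.IsPos i ↔ P.root i ∈ AddSubmonoid.closure (P.root '' b.support) := by
  obtain ⟨ω, hω⟩ := exists_fundamentalCoweights P b
  classical
  have hρ : ∀ j ∈ b.support, rootFun P j (∑ i ∈ b.support, ω i) = 1 := by
    intro j hj
    rw [map_sum, Finset.sum_eq_single_of_mem j hj, (hω j hj j hj).1 rfl]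
    intro i hi hij
    exact (hω i hi j hj).2 hij
  have hnn : ∀ j ∈ b.support, 0 ≤ rootFun P j (∑ i ∈ b.support, ω i) := fun j hj => by
    rw [hρ j hj]; exact zero_le_one
  have hh := rootFun_eq_height b hρ i
  constructor
  · intro hi
    refine (b.root_mem_or_neg_mem i).resolve_right fun hneg => ?_
    have := weightFun_nonneg hnn hneg
    rw [map_neg, LinearMap.neg_apply, weightFun_root, hh] at this
    have h2 : (0 : ℝ) < b.height i := by exact_mod_cast hi
    linarith
  · intro hi
    have := weightFun_nonneg hnn hi
    rw [weightFun_root, hh] at this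
    rw [RootPairing.Base.isPos_iff']
    exact_mod_cast this

omit [Finite ι] [Module.Finite ℤ N] in
lemma isPos_or_isPos_neg (i : ι) : b.IsPos i ∨ b.IsPos (P.reflectionPerm i i) :=
  RootPairing.Base.IsPos.or_neg b i

variable {b} in
omit [Finite ι] [Module.Finite ℤ N] in
lemma not_isPos_neg {i : ι} (hi : b.IsPos i) : ¬ b.IsPos (P.reflectionPerm i i) := fun h =>
  (RootPairing.Base.IsPos.neg_iff_not b i).1 h hi

omit [Finite ι] in
lemma rootFun_nonneg {x : CoweightSpace N} (hx : ∀ i ∈ b.support, 0 ≤ rootFun P i x)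
    {i : ι} (hi : b.IsPos i) : 0 ≤ rootFun P i x := by
  rw [← weightFun_root]
  exact weightFun_nonneg hx ((isPos_iff_mem_closure b).1 hi)

/-- The height is evaluation at a point of the folded space, where roots of one orbit agree. -/
lemma height_aut (hΘ : ∀ i, i ∈ b.support → Θ.indexEquiv i ∈ b.support) (i : ι) :
    b.height (Θ.indexEquiv i) = b.height i := by
  obtain ⟨ρ, hρ, hρ1⟩ := exists_foldedRho b Θ hΘ
  have := rootFun_aut_of_mem hρ i
  rw [rootFun_eq_height b hρ1, rootFun_eq_height b hρ1] at this
  exact_mod_cast this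

variable {b Θ}

lemma height_eq_of_mem_orbit (hΘ : ∀ i, i ∈ b.support → Θ.indexEquiv i ∈ b.support) {i j : ι}
    (hj : j ∈ orbit P Θ i) : b.height j = b.height i :=
  eq_of_mem_orbit (height_aut b Θ hΘ) hj

/-- Distinct roots in one orbit never form an acute angle. -/
lemma pairing_nonpos_of_mem_orbit
    (hΘ : ∀ i, i ∈ b.support → Θ.indexEquiv i ∈ b.support) {i j : ι} (hj : j ∈ orbit P Θ i)
    (hij : i ≠ j) : P.pairing i j ≤ 0 := by
  by_contra! h
  have h' : 0 < P.pairingIn ℤ i j := by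
    have := P.algebraMap_pairingIn ℤ i j
    simp only [algebraMap_int_eq, eq_intCast, Int.cast_eq] at this
    rwa [this]
  -- A positive pairing makes the difference a root, but its height would be zero.
  obtain ⟨k, hk⟩ := P.root_sub_root_mem_of_pairingIn_pos h' hij
  have := b.height_sub hk
  rw [height_eq_of_mem_orbit hΘ hj, sub_self] at this
  exact b.height_ne_zero k this

lemma sum_pairing_le_two (hΘ : ∀ i, i ∈ b.support → Θ.indexEquiv i ∈ b.support) (i : ι) :
    ∑ j ∈ orbitFinset P Θ i, P.pairing i j ≤ 2 := by
  classical
  rw [← Finset.add_sum_erase _ _ (show i ∈ orbitFinset P Θ i by simpa using self_mem_orbit P Θ i)]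
  have : ∑ j ∈ (orbitFinset P Θ i).erase i, P.pairing i j ≤ 0 := by
    refine Finset.sum_nonpos fun j hj => ?_
    rw [Finset.mem_erase, mem_orbitFinset] at hj
    exact pairing_nonpos_of_mem_orbit hΘ hj.2 hj.1.symm
  have h2 : P.pairing i i = 2 := P.pairing_same i
  omega

omit [Module.Finite ℤ N] in
-- This computes the invariant form on two orbit sums. The row sums do not depend on the root chosen
-- in the orbit of `m`, because the coroot sum lies in the folded space, and root lengths are
-- constant on the orbit of `k`.
lemma two_mul_sum_rootForm [Fintype ι] (m k : ι) :
    2 * ∑ i ∈ orbitFinset P Θ m, ∑ j ∈ orbitFinset P Θ k, P.RootForm (P.root i) (P.root j) =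
      (orbitFinset P Θ m).card * (P.RootForm (P.root k) (P.root k) *
        ∑ j ∈ orbitFinset P Θ k, P.pairing m j) := by
  have hinv : ∀ j, P.RootForm (P.root (Θ.indexEquiv j)) (P.root (Θ.indexEquiv j)) =
      P.RootForm (P.root j) (P.root j) := by
    intro j
    rw [P.rootForm_root_self, P.rootForm_root_self]
    refine (Finset.sum_equiv Θ.indexEquiv (by simp) fun k _ => ?_).symm
    rw [pairing_aut]
  rw [← nsmul_eq_mul, ← Finset.sum_const, Finset.mul_sum]
  refine Finset.sum_congr rfl fun i hi => ?_
  have hrow := rootFun_eq_of_mem_orbit (corootSum_mem P Θ k) ((mem_orbitFinset P Θ).1 hi)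
  rw [rootFun_corootSum, rootFun_corootSum] at hrow
  rw [← Int.cast_inj.1 hrow, Finset.mul_sum, Finset.mul_sum]
  refine Finset.sum_congr rfl fun j hj => ?_
  have h3 := P.toInvariantForm.two_mul_apply_root_root i j
  simp only [RootPairing.toInvariantForm_form] at h3
  rw [h3, eq_of_mem_orbit (f := fun j => P.RootForm (P.root j) (P.root j)) hinv
    ((mem_orbitFinset P Θ).1 hj), mul_comm]

omit [Finite ι] [Module.Finite ℤ N] in
lemma rootForm_root_self_pos [Fintype ι] (i : ι) : 0 < P.RootForm (P.root i) (P.root i) :=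
  P.rootForm_pos_of_ne_zero (Submodule.subset_span ⟨i, rfl⟩) (P.ne_zero i)

omit [Module.Finite ℤ N] in
-- Up to positive factors both sums are the invariant form of the two orbit sums, which is
-- symmetric.
lemma sum_pairing_pos_comm {m k : ι} (h : 0 < ∑ j ∈ orbitFinset P Θ k, P.pairing m j) :
    0 < ∑ j ∈ orbitFinset P Θ m, P.pairing k j := by
  cases nonempty_fintype ι
  have h1 := two_mul_sum_rootForm (Θ := Θ) m k
  have h2 := two_mul_sum_rootForm (Θ := Θ) k m
  rw [Finset.sum_comm] at h2
  have hcomm : ∀ i j, P.RootForm (P.root i) (P.root j) = P.RootForm (P.root j) (P.root i) :=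
    fun i j => by simpa using P.rootForm_symmetric.eq (P.root i) (P.root j)
  have h3 : ∑ i ∈ orbitFinset P Θ m, ∑ j ∈ orbitFinset P Θ k, P.RootForm (P.root i) (P.root j) =
      ∑ i ∈ orbitFinset P Θ m, ∑ j ∈ orbitFinset P Θ k, P.RootForm (P.root j) (P.root i) :=
    Finset.sum_congr rfl fun i _ => Finset.sum_congr rfl fun j _ => hcomm i j
  rw [h3, h2] at h1
  have c1 : (0 : ℤ) < (orbitFinset P Θ m).card := by exact_mod_cast orbitFinset_card_pos P Θ m
  have c2 : (0 : ℤ) < (orbitFinset P Θ k).card := by exact_mod_cast orbitFinset_card_pos P Θ k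
  have c3 := rootForm_root_self_pos (P := P) m
  have c4 := rootForm_root_self_pos (P := P) k
  have h4 := mul_pos c1 (mul_pos c4 h)
  rw [← h1] at h4
  exact pos_of_mul_pos_right (pos_of_mul_pos_right h4 c2.le) c3.le

/-- The orbit sum is nonzero, since at `ρ` it is the orbit size times a nonzero height. The form is
positive definite on the root span, and its value on the orbit sum is a positive multiple of the
number in question. -/
lemma sum_pairing_pos (hΘ : ∀ i, i ∈ b.support → Θ.indexEquiv i ∈ b.support) (i : ι) :
    0 < ∑ j ∈ orbitFinset P Θ i, P.pairing i j := by
  cases nonempty_fintype ι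
  have hcard := orbitFinset_card_pos P Θ i
  set S : M := ∑ j ∈ orbitFinset P Θ i, P.root j with hS
  have hSne : S ≠ 0 := by
    intro h0
    obtain ⟨ρ, hρ, hρ1⟩ := exists_foldedRho b Θ hΘ
    have h1 : weightFun P S ρ = (orbitFinset P Θ i).card * rootFun P i ρ := by
      rw [hS, map_sum, LinearMap.coe_sum, Finset.sum_apply,
        Finset.sum_congr rfl fun j hj => by
          rw [weightFun_root, rootFun_eq_of_mem_orbit hρ ((mem_orbitFinset P Θ).1 hj)]]
      simp
    rw [h0, rootFun_eq_height b hρ1] at h1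
    simp only [map_zero, LinearMap.zero_apply, zero_eq_mul, Nat.cast_eq_zero, Int.cast_eq_zero,
      b.height_ne_zero, or_false] at h1
    omega
  have hSspan : S ∈ P.rootSpan ℤ :=
    Submodule.sum_mem _ fun j _ => Submodule.subset_span ⟨j, rfl⟩
  have hpos := P.rootForm_pos_of_ne_zero hSspan hSne
  have h2 := two_mul_sum_rootForm (Θ := Θ) i i
  have h3 : P.RootForm S S = ∑ k ∈ orbitFinset P Θ i, ∑ j ∈ orbitFinset P Θ i,
      P.RootForm (P.root k) (P.root j) := by
    rw [hS]
    simp only [map_sum, LinearMap.coe_sum, Finset.sum_apply]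
    rw [Finset.sum_comm]
  rw [h3] at hpos
  have h4 : (0 : ℤ) < (orbitFinset P Θ i).card * (P.RootForm (P.root i) (P.root i) *
      ∑ j ∈ orbitFinset P Θ i, P.pairing i j) := by
    rw [← h2]
    linarith
  exact pos_of_mul_pos_right (pos_of_mul_pos_right h4 (by positivity))
    (rootForm_root_self_pos i).le

/-- If the restriction of a root is a smaller multiple of another, it is half of it. -/
lemma eq_half_of_restrictedRoot_eq_smul
    (hΘ : ∀ i, i ∈ b.support → Θ.indexEquiv i ∈ b.support) {i j : ι} {c : ℝ} (h0 : 0 < c)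
    (h1 : c < 1) (h : restrictedRoot P Θ i = c • restrictedRoot P Θ j) : c = 1 / 2 := by
  have h2 := LinearMap.congr_fun h ⟨corootSum P Θ j, corootSum_mem P Θ j⟩
  simp only [restrictedRoot_apply, LinearMap.smul_apply, smul_eq_mul] at h2
  rw [rootFun_corootSum, rootFun_corootSum] at h2
  have h3 := sum_pairing_pos hΘ j
  have h4 := sum_pairing_le_two hΘ j
  set g := ∑ k ∈ orbitFinset P Θ j, P.pairing j k
  set f := ∑ k ∈ orbitFinset P Θ j, P.pairing i k
  have h5 : (0 : ℝ) < g := by exact_mod_cast h3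
  have hf0 : (0 : ℝ) < f := by rw [h2]; positivity
  have hfg : (f : ℝ) < g := by rw [h2]; nlinarith
  have hf0' : 0 < f := by exact_mod_cast hf0
  have hfg' : f < g := by exact_mod_cast hfg
  -- The integers satisfy `0 < f < g ≤ 2`.
  have hf1 : f = 1 := by omega
  have hg2 : g = 2 := by omega
  rw [hf1, hg2] at h2
  push_cast at h2
  linarith

lemma restrictedRoot_ne_zero (hΘ : ∀ i, i ∈ b.support → Θ.indexEquiv i ∈ b.support) (i : ι) :
    restrictedRoot P Θ i ≠ 0 := by
  obtain ⟨ρ, hρ, hρ1⟩ := exists_foldedRho b Θ hΘ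
  intro h
  have h1 := LinearMap.congr_fun h ⟨ρ, hρ⟩
  simp only [restrictedRoot_apply, rootFun_eq_height b hρ1, LinearMap.zero_apply,
    Int.cast_eq_zero] at h1
  exact b.height_ne_zero i h1

/-- A root that is not long restricts to half of a long root. -/
lemma exists_isLong (hΘ : ∀ i, i ∈ b.support → Θ.indexEquiv i ∈ b.support) {i : ι}
    (hi : ¬ IsLong P Θ i) :
    ∃ j, IsLong P Θ j ∧ restrictedRoot P Θ i = (1 / 2 : ℝ) • restrictedRoot P Θ j := by
  simp only [IsLong, not_forall, not_not] at hi
  obtain ⟨j, c, h0, h1, h⟩ := hi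
  obtain rfl := eq_half_of_restrictedRoot_eq_smul hΘ h0 h1 h
  refine ⟨j, fun k c h0 h1 h' => ?_, h⟩
  rw [h', smul_smul] at h
  -- A further multiple would have total factor `1/2 * c`, which must again be `1/2`; this
  -- contradicts `c < 1`.
  have h2 := eq_half_of_restrictedRoot_eq_smul hΘ (by positivity) (by linarith) h
  linarith

lemma isLong_of_forall_half (hΘ : ∀ i, i ∈ b.support → Θ.indexEquiv i ∈ b.support) {i : ι}
    (h : ∀ j, restrictedRoot P Θ i ≠ (1 / 2 : ℝ) • restrictedRoot P Θ j) : IsLong P Θ i := by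
  intro j c h0 h1 h2
  rw [eq_half_of_restrictedRoot_eq_smul hΘ h0 h1 h2] at h2
  exact h j h2

omit [Finite ι] [Module.Finite ℤ N] in
lemma eq_one_of_isLong {i j : ι} (hi : IsLong P Θ i)
    (hj : IsLong P Θ j) {c : ℝ} (h0 : 0 < c)
    (h : restrictedRoot P Θ i = c • restrictedRoot P Θ j) : c = 1 := by
  rcases lt_trichotomy c 1 with h1 | h1 | h1
  · exact absurd h (hi j c h0 h1)
  · exact h1
  · refine absurd ?_ (hj i c⁻¹ (by positivity) (inv_lt_one_of_one_lt₀ h1))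
    rw [h, smul_smul, inv_mul_cancel₀ h0.ne', one_smul]

end Heights

/-! ### The base of the folded root system -/

section FoldedBase

variable {ι M N : Type*} [Finite ι] [AddCommGroup M] [AddCommGroup N] [Module.Finite ℤ N]
  {P : RootDatum ι M N} {b : P.Base} {Θ : P.Aut}

omit [Finite ι] [Module.Finite ℤ N] in
lemma weightFun_mem_closure_iff {s : Set ι} {m : M} :
    weightFun P m ∈ AddSubmonoid.closure (rootFun P '' s) ↔
      m ∈ AddSubmonoid.closure (P.root '' s) := by
  have h : AddSubmonoid.closure (rootFun P '' s) =
      (AddSubmonoid.closure (P.root '' s)).map (weightFun P : M →+ _) := by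
    rw [AddMonoidHom.map_mclosure, Set.image_image]
    rfl
  rw [h, AddSubmonoid.mem_map]
  constructor
  · rintro ⟨m', hm', h'⟩
    rwa [← weightFun_injective P h']
  · intro hm
    exact ⟨m, hm, rfl⟩

omit [Finite ι] in
/-- The folded fundamental coweights detect the support of a positive root. -/
lemma root_mem_closure_orbit {ω : ι → CoweightSpace N}
    (hω : ∀ i ∈ b.support, ∀ j ∈ b.support,
        (j ∈ orbit P Θ i → 0 < rootFun P j (ω i)) ∧ (j ∉ orbit P Θ i → rootFun P j (ω i) = 0))
    {i m : ι} (hm : b.IsPos m)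
    (h : ∀ k ∈ b.support, k ∉ orbit P Θ i → rootFun P m (ω k) = 0) :
    P.root m ∈ AddSubmonoid.closure (P.root '' orbit P Θ i) := by
  have hm' := (isPos_iff_mem_closure b).1 hm
  obtain ⟨f, hf⟩ : ∃ f : ι → ℕ, P.root m = ∑ k ∈ b.support, f k • P.root k := by
    classical
    rw [← Submodule.span_nat_eq_addSubmonoidClosure, Submodule.mem_toAddSubmonoid,
      Submodule.mem_span_image_finset_iff_exists_fun] at hm'
    obtain ⟨f, hf⟩ := hm'
    refine ⟨fun k => if hk : k ∈ b.support then f ⟨k, hk⟩ else 0, ?_⟩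
    rw [← hf, ← Finset.sum_coe_sort b.support]
    exact Finset.sum_congr rfl fun k _ => by simp
  rw [hf]
  refine AddSubmonoid.sum_mem _ fun k hk => ?_
  by_cases hki : k ∈ orbit P Θ i
  · exact AddSubmonoid.nsmul_mem _ (AddSubmonoid.subset_closure (Set.mem_image_of_mem _ hki)) _
  -- The value of the root at `ω k` is a sum of nonnegative terms, so its vanishing kills the
  -- coefficient of `k`.
  · have h1 := h k hk hki
    rw [← weightFun_root, hf, map_sum, LinearMap.coe_sum, Finset.sum_apply,
      Finset.sum_eq_zero_iff_of_nonneg] at h1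
    · have h2 := h1 k hk
      rw [map_nsmul, LinearMap.smul_apply, weightFun_root, nsmul_eq_mul, mul_eq_zero] at h2
      rcases h2 with h2 | h2
      · rw [Nat.cast_eq_zero.1 h2, zero_smul]
        exact zero_mem _
      · exact absurd h2 ((hω k hk k hk).1 (self_mem_orbit P Θ k)).ne'
    · intro l hl
      rw [map_nsmul, LinearMap.smul_apply, weightFun_root, nsmul_eq_mul]
      refine mul_nonneg (Nat.cast_nonneg _) ?_
      by_cases hlk : l ∈ orbit P Θ k
      · exact ((hω k hk l hl).1 hlk).le
      · exact ((hω k hk l hl).2 hlk).ge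

omit [Finite ι] [Module.Finite ℤ N] in
lemma eq_zero_of_mem_span {s : Set ι} {x : CoweightSpace N} (hx : ∀ i ∈ s, rootFun P i x = 0)
    {f : Module.Dual ℝ (CoweightSpace N)} (hf : f ∈ Submodule.span ℝ (rootFun P '' s)) :
    f x = 0 := by
  induction hf using Submodule.span_induction with
  | mem f hf => obtain ⟨i, hi, rfl⟩ := hf; exact hx i hi
  | zero => rfl
  | add f g _ _ hf hg => rw [LinearMap.add_apply, hf, hg, add_zero]
  | smul c f _ hf => rw [LinearMap.smul_apply, hf, smul_zero]

omit [Finite ι] [Module.Finite ℤ N] in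
lemma rootFun_mem_span_of_mem_closure {s : Set ι} {m : M}
    (hm : m ∈ AddSubmonoid.closure (P.root '' s)) :
    weightFun P m ∈ Submodule.span ℝ (rootFun P '' s) := by
  have := weightFun_mem_closure_iff.2 hm
  exact (AddSubmonoid.closure_le (S := (Submodule.span ℝ (rootFun P '' s)).toAddSubmonoid)).2
    Submodule.subset_span this

omit [Finite ι] [Module.Finite ℤ N] in
/-- A nonzero sum of simple roots has height at least one. -/
lemma eq_zero_or_one_le {ρ : CoweightSpace N} {s : Set ι} (hρ : ∀ i ∈ s, rootFun P i ρ = 1)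
    {m : M} (hm : m ∈ AddSubmonoid.closure (P.root '' s)) : m = 0 ∨ 1 ≤ weightFun P m ρ := by
  induction hm using AddSubmonoid.closure_induction with
  | mem y hy =>
    obtain ⟨i, hi, rfl⟩ := hy
    exact Or.inr (hρ i hi).ge
  | zero => exact Or.inl rfl
  | add y z _ _ hy hz =>
    rw [map_add, LinearMap.add_apply]
    rcases hy with rfl | hy
    · simpa using hz
    · rcases hz with rfl | hz
      · right; simpa using hy
      · right; linarith

-- Highest roots of orbits of simple roots, and the folded simple roots.

section Orbits

/-- The roots in the span of an orbit of simple roots, in terms of sums of simple roots. -/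
lemma root_mem_closure_of_mem_span (hΘ : ∀ i, i ∈ b.support → Θ.indexEquiv i ∈ b.support)
    {i m : ι} (hi : i ∈ b.support) (hm : b.IsPos m)
    (h : rootFun P m ∈ Submodule.span ℝ (rootFun P '' orbit P Θ i)) :
    P.root m ∈ AddSubmonoid.closure (P.root '' orbit P Θ i) := by
  obtain ⟨ω, -, hω⟩ := exists_foldedCoweights b Θ hΘ
  refine root_mem_closure_orbit hω hm fun k hk hki => eq_zero_of_mem_span (fun j hj => ?_) h
  refine (hω k hk j (mem_support_of_mem_orbit hΘ hi hj)).2 fun hjk => hki ?_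
  rw [← orbit_eq_of_mem P Θ hj, orbit_eq_of_mem P Θ hjk]
  exact self_mem_orbit P Θ k

/-- A negative root of the span is not maximal: its negative exceeds it by twice a sum of simple
roots of the orbit. -/
lemma IsHighestIn.isPos (hΘ : ∀ i, i ∈ b.support → Θ.indexEquiv i ∈ b.support)
    {i j : ι} (hi : i ∈ b.support) (hj : IsHighestIn P (orbit P Θ i) j) : b.IsPos j := by
  by_contra hneg
  have hpos := (isPos_or_isPos_neg b j).resolve_left hneg
  have hspan : rootFun P (P.reflectionPerm j j) ∈
      Submodule.span ℝ (rootFun P '' orbit P Θ i) := by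
    rw [rootFun_neg]
    exact Submodule.neg_mem _ hj.1
  have hcl := weightFun_mem_closure_iff.2 (root_mem_closure_of_mem_span hΘ hi hpos hspan)
  have heq := hj.2 _ hspan (by
    have : rootFun P (P.reflectionPerm j j) - rootFun P j =
        weightFun P (P.root (P.reflectionPerm j j)) +
          weightFun P (P.root (P.reflectionPerm j j)) := by
      rw [weightFun_root, rootFun_neg]; abel
    rw [this]
    exact add_mem hcl hcl)
  rw [heq] at hpos
  exact hneg hpos

lemma IsHighestIn.mem_closure (hΘ : ∀ i, i ∈ b.support → Θ.indexEquiv i ∈ b.support)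
    {i j : ι} (hi : i ∈ b.support) (hj : IsHighestIn P (orbit P Θ i) j) :
    P.root j ∈ AddSubmonoid.closure (P.root '' orbit P Θ i) :=
  root_mem_closure_of_mem_span hΘ hi (hj.isPos hΘ hi) hj.1

omit [Finite ι] [Module.Finite ℤ N] in
lemma IsHighestIn.eq_zero {i j m : ι} (hj : IsHighestIn P (orbit P Θ i) j)
    {x : M} (hx : x ∈ AddSubmonoid.closure (P.root '' orbit P Θ i))
    (hm : P.root m = P.root j + x) : x = 0 := by
  have hm' : rootFun P m = rootFun P j + weightFun P x := by
    rw [← weightFun_root, hm, map_add]; rfl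
  have := hj.2 m (by
      rw [hm']
      exact Submodule.add_mem _ hj.1 (rootFun_mem_span_of_mem_closure hx)) (by
      rw [hm', add_sub_cancel_left]
      exact weightFun_mem_closure_iff.2 hx)
  rw [this] at hm
  simpa using hm

/-- A root of the span with the largest value at `ρ` is maximal, because a nonzero sum of simple
roots has value at least one there. -/
lemma exists_isHighestIn (hΘ : ∀ i, i ∈ b.support → Θ.indexEquiv i ∈ b.support)
    {i : ι} (hi : i ∈ b.support) : ∃ j, IsHighestIn P (orbit P Θ i) j := by
  obtain ⟨ρ, hρ, hρ1⟩ := exists_foldedRho b Θ hΘ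
  obtain ⟨j, hj, hmax⟩ := Set.exists_max_image
    {m | rootFun P m ∈ Submodule.span ℝ (rootFun P '' orbit P Θ i)} (fun m => rootFun P m ρ)
    (Set.toFinite _) ⟨i, Submodule.subset_span ⟨i, self_mem_orbit P Θ i, rfl⟩⟩
  refine ⟨j, hj, fun m hm hmj => ?_⟩
  rw [← weightFun_root, ← weightFun_root, ← map_sub, weightFun_mem_closure_iff] at hmj
  rcases eq_zero_or_one_le (fun k hk => hρ1 k (mem_support_of_mem_orbit hΘ hi hk)) hmj with h | h
  · exact P.root.injective (sub_eq_zero.1 h)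
  · rw [map_sub, LinearMap.sub_apply, weightFun_root, weightFun_root] at h
    have : rootFun P m ρ ≤ rootFun P j ρ := hmax m hm
    linarith

omit [Module.Finite ℤ N] in
/-- On the folded space a sum of simple roots in one orbit is a multiple of each of them. -/
lemma exists_restrict_eq_nsmul {i : ι} {x : M}
    (hx : x ∈ AddSubmonoid.closure (P.root '' orbit P Θ i)) :
    ∃ n : ℕ, ∀ y ∈ foldedSpace P Θ, weightFun P x y = n * rootFun P i y := by
  induction hx using AddSubmonoid.closure_induction with
  | mem x hx =>
    obtain ⟨j, hj, rfl⟩ := hx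
    exact ⟨1, fun y hy => by rw [weightFun_root, rootFun_eq_of_mem_orbit hy hj]; simp⟩
  | zero => exact ⟨0, fun y _ => by simp⟩
  | add x y _ _ hx hy =>
    obtain ⟨n, hn⟩ := hx
    obtain ⟨m, hm⟩ := hy
    exact ⟨n + m, fun z hz => by
      rw [map_add, LinearMap.add_apply, hn z hz, hm z hz]; push_cast; ring⟩

omit [Module.Finite ℤ N] in
lemma exists_restrictedRoot_eq_smul {i j : ι}
    (hj : P.root j ∈ AddSubmonoid.closure (P.root '' orbit P Θ i)) (hpos : restrictedRoot P Θ j ≠ 0) :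
    ∃ c : ℝ, 0 < c ∧ restrictedRoot P Θ j = c • restrictedRoot P Θ i := by
  obtain ⟨n, hn⟩ := exists_restrict_eq_nsmul hj
  have heq : restrictedRoot P Θ j = (n : ℝ) • restrictedRoot P Θ i := by
    ext y
    exact hn y y.2
  refine ⟨n, lt_of_le_of_ne n.cast_nonneg fun h => hpos ?_, heq⟩
  rw [heq, ← h, zero_smul]

/-- The coefficients of a positive root outside an orbit are detected on the folded space. -/
lemma root_mem_closure_of_restrictedRoot_eq
    (hΘ : ∀ i, i ∈ b.support → Θ.indexEquiv i ∈ b.support) {i m : ι}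
    (hi : i ∈ b.support) (hm : b.IsPos m) {c : ℝ}
    (h : restrictedRoot P Θ m = c • restrictedRoot P Θ i) :
    P.root m ∈ AddSubmonoid.closure (P.root '' orbit P Θ i) := by
  obtain ⟨ω, hω1, hω⟩ := exists_foldedCoweights b Θ hΘ
  refine root_mem_closure_orbit hω hm fun k hk hki => ?_
  have h1 := LinearMap.congr_fun h ⟨ω k, hω1 k⟩
  simp only [restrictedRoot_apply, LinearMap.smul_apply, smul_eq_mul] at h1
  rw [h1, (hω k hk i hi).2, mul_zero]
  exact fun h => hki (Equiv.Perm.SameCycle.symm h)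

omit [Finite ι] [Module.Finite ℤ N] in
lemma pairingIn_int (i j : ι) : P.pairingIn ℤ i j = P.pairing i j := by
  have := P.algebraMap_pairingIn ℤ i j
  simpa only [algebraMap_int_eq, eq_intCast, Int.cast_eq] using this

omit [Module.Finite ℤ N] in
lemma sum_pairing_eq_of_mem_orbit {i j k : ι} (hj : j ∈ orbit P Θ i) :
    ∑ l ∈ orbitFinset P Θ k, P.pairing j l = ∑ l ∈ orbitFinset P Θ k, P.pairing i l := by
  have := rootFun_eq_of_mem_orbit (corootSum_mem P Θ k) hj
  rw [rootFun_corootSum, rootFun_corootSum] at this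
  exact_mod_cast this

lemma mem_closure_orbit_of_mem_orbit (hΘ : ∀ i, i ∈ b.support → Θ.indexEquiv i ∈ b.support)
    {i j k : ι} (hi : i ∈ b.support) (hk : k ∈ orbit P Θ j) (hjpos : b.IsPos j)
    (hj : P.root j ∈ AddSubmonoid.closure (P.root '' orbit P Θ i)) :
    P.root k ∈ AddSubmonoid.closure (P.root '' orbit P Θ i) := by
  obtain ⟨n, hn⟩ := exists_restrict_eq_nsmul hj
  refine root_mem_closure_of_restrictedRoot_eq hΘ hi (c := n) ?_ ?_
  · rw [RootPairing.Base.isPos_iff, height_eq_of_mem_orbit hΘ hk]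
    exact hjpos
  · rw [restrictedRoot_eq_of_mem_orbit P Θ hk]
    ext y
    exact hn y y.2

/-- The orbit of a highest root consists of pairwise orthogonal roots. -/
lemma IsHighestIn.pairing_eq_zero (hΘ : ∀ i, i ∈ b.support → Θ.indexEquiv i ∈ b.support)
    {i j : ι} (hi : i ∈ b.support) (hj : IsHighestIn P (orbit P Θ i) j) {k l : ι}
    (hk : k ∈ orbit P Θ j) (hl : l ∈ orbit P Θ j) (hkl : k ≠ l) : P.pairing k l = 0 := by
  classical
  have hjpos := hj.isPos hΘ hi
  -- A negative pairing would make the sum of the roots `j` and `l` a root, against the maximality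
  -- of `j`.
  have hbase : ∀ l ∈ orbit P Θ j, l ≠ j → P.pairing j l = 0 := by
    intro l hl hlj
    refine le_antisymm (pairing_nonpos_of_mem_orbit hΘ hl hlj.symm) ?_
    by_contra! hneg
    have hlpos : b.IsPos l := by
      rw [RootPairing.Base.isPos_iff, height_eq_of_mem_orbit hΘ hl]
      exact hjpos
    obtain ⟨m, hm⟩ := P.root_add_root_mem_of_pairingIn_neg (by rwa [pairingIn_int]) (by
      intro h
      have h' : P.reflectionPerm l l = j := rootFun_injective P (by
        rw [rootFun_neg, ← weightFun_root, ← weightFun_root, h, map_neg])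
      exact not_isPos_neg hlpos (h' ▸ hjpos))
    exact P.ne_zero l (hj.eq_zero
      (mem_closure_orbit_of_mem_orbit hΘ hi hl hjpos (hj.mem_closure hΘ hi)) hm)
  -- Row sums of the pairing matrix are constant on the orbit, so each is 2 like that of `j`. The
  -- diagonal entry is already 2 and the others are nonpositive, hence zero.
  have hsum : ∀ k ∈ orbit P Θ j, ∑ l ∈ orbitFinset P Θ j, P.pairing k l = 2 := by
    intro k hk
    rw [sum_pairing_eq_of_mem_orbit hk, Finset.sum_eq_single_of_mem j
      (by simpa using self_mem_orbit P Θ j) fun l hl hlj =>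
        hbase l ((mem_orbitFinset P Θ).1 hl) hlj]
    exact P.pairing_same j
  have h1 := hsum k hk
  rw [← Finset.add_sum_erase _ _ ((mem_orbitFinset P Θ).2 hk), P.pairing_same,
    add_eq_left] at h1
  rw [← orbit_eq_of_mem P Θ hk] at hl
  refine (Finset.sum_eq_zero_iff_of_nonpos fun l hl => ?_).1 h1 l ?_
  · rw [Finset.mem_erase, mem_orbitFinset, ← orbit_eq_of_mem P Θ hk] at hl
    exact pairing_nonpos_of_mem_orbit hΘ hl.2 hl.1.symm
  · rw [Finset.mem_erase, mem_orbitFinset, ← orbit_eq_of_mem P Θ hk]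
    exact ⟨hkl.symm, hl⟩

lemma IsHighestIn.sum_pairing (hΘ : ∀ i, i ∈ b.support → Θ.indexEquiv i ∈ b.support)
    {i j : ι} (hi : i ∈ b.support) (hj : IsHighestIn P (orbit P Θ i) j) :
    ∑ l ∈ orbitFinset P Θ j, P.pairing j l = 2 := by
  rw [Finset.sum_eq_single_of_mem j (by simpa using self_mem_orbit P Θ j) fun l hl hlj =>
    hj.pairing_eq_zero hΘ hi (self_mem_orbit P Θ j) ((mem_orbitFinset P Θ).1 hl) hlj.symm]
  exact P.pairing_same j

omit [Module.Finite ℤ N] in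
lemma exists_pairing_eq {m j k : ι} (hk : k ∈ orbit P Θ j) :
    ∃ l ∈ orbit P Θ m, P.pairing l j = P.pairing m k := by
  obtain ⟨n, -, rfl⟩ := Equiv.Perm.SameCycle.exists_pow_eq' (Equiv.Perm.SameCycle.symm hk)
  refine ⟨((Θ.indexEquiv : Equiv.Perm ι) ^ n) m, ⟨n, by simp⟩, ?_⟩
  clear hk
  induction n with
  | zero => simp
  | succ n ih =>
    rw [pow_succ', Equiv.Perm.mul_apply, Equiv.Perm.mul_apply]
    exact (pairing_aut P Θ _ _).trans ih

/-- Highest roots of orbits of simple roots restrict to long roots. -/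
lemma IsHighestIn.isLong (hΘ : ∀ i, i ∈ b.support → Θ.indexEquiv i ∈ b.support)
    {i j : ι} (hi : i ∈ b.support) (hj : IsHighestIn P (orbit P Θ i) j) : IsLong P Θ j := by
  refine isLong_of_forall_half hΘ fun m hm => ?_
  have hjpos := hj.isPos hΘ hi
  obtain ⟨ρ, hρ, hρ1⟩ := exists_foldedRho b Θ hΘ
  have hm2 : ∀ y ∈ foldedSpace P Θ, rootFun P m y = 2 * rootFun P j y := by
    intro y hy
    have := LinearMap.congr_fun hm ⟨y, hy⟩
    simp only [restrictedRoot_apply, LinearMap.smul_apply, smul_eq_mul] at this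
    linarith
  have hht : b.height m = 2 * b.height j := by
    have := hm2 ρ hρ
    rw [rootFun_eq_height b hρ1, rootFun_eq_height b hρ1] at this
    exact_mod_cast this
  have hpos : 0 < ∑ l ∈ orbitFinset P Θ j, P.pairing m l := by
    have h1 := hm2 _ (corootSum_mem P Θ j)
    rw [rootFun_corootSum, rootFun_corootSum, hj.sum_pairing hΘ hi] at h1
    have h2 : ∑ l ∈ orbitFinset P Θ j, P.pairing m l = 2 * 2 := by exact_mod_cast h1
    rw [h2]
    norm_num
  -- Some conjugate `l` of `m` pairs positively with `j` itself, so `l - j` is a root `d`. It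
  -- restricts like `j`, hence is a sum of simple roots of the orbit, and `j + d` being a root
  -- contradicts maximality.
  obtain ⟨k, hk, hmk⟩ := Finset.exists_lt_of_sum_lt (f := fun _ => (0 : ℤ)) (by simpa using hpos)
  obtain ⟨l, hl, hlj⟩ := exists_pairing_eq (m := m) ((mem_orbitFinset P Θ).1 hk)
  rw [← hlj] at hmk
  have hjh : 0 < b.height j := hjpos
  have hlh : b.height l = 2 * b.height j := by rw [height_eq_of_mem_orbit hΘ hl, hht]
  obtain ⟨d, hd⟩ := P.root_sub_root_mem_of_pairingIn_pos (i := l) (j := j)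
    (by rwa [pairingIn_int]) (by rintro rfl; omega)
  have hdh := b.height_sub hd
  have hdpos : b.IsPos d := by rw [RootPairing.Base.isPos_iff]; omega
  obtain ⟨n, hn⟩ := exists_restrict_eq_nsmul (hj.mem_closure hΘ hi)
  have hdcl : P.root d ∈ AddSubmonoid.closure (P.root '' orbit P Θ i) := by
    refine root_mem_closure_of_restrictedRoot_eq hΘ hi hdpos (c := n) ?_
    ext y
    have h1 : rootFun P d y = rootFun P l y - rootFun P j y := by
      rw [← weightFun_root, hd, map_sub]; rfl
    have h2 := hn y y.2
    rw [weightFun_root] at h2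
    rw [restrictedRoot_apply, h1, rootFun_eq_of_mem_orbit y.2 hl, hm2 y y.2,
      LinearMap.smul_apply, restrictedRoot_apply, smul_eq_mul, ← h2]
    ring
  exact P.ne_zero d (hj.eq_zero (m := l) hdcl (by rw [hd]; abel))

omit [Module.Finite ℤ N] in
lemma mem_foldedSimpleRoots {f : Module.Dual ℝ (foldedSpace P Θ)} :
    f ∈ foldedSimpleRoots P b Θ ↔
      ∃ i ∈ b.support, ∃ j, IsHighestIn P (orbit P Θ i) j ∧ f = restrictedRoot P Θ j := by
  simp only [foldedSimpleRoots, restrictFun_orbitAverage, Set.mem_ofPred_eq]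

omit [Finite ι] [Module.Finite ℤ N] in
/-- The product of reflections in pairwise orthogonal roots. -/
lemma exists_rootFun_eq_sub_sum {T : Finset ι}
    (hT : ∀ k ∈ T, ∀ l ∈ T, k ≠ l → P.pairing k l = 0) (m : ι) :
    ∃ m', rootFun P m' = rootFun P m - ∑ l ∈ T, (P.pairing m l : ℝ) • rootFun P l := by
  classical
  induction T using Finset.induction_on with
  | empty => exact ⟨m, by simp⟩
  | insert a T ha ih =>
    obtain ⟨m', hm'⟩ := ih fun k hk l hl => hT k (Finset.mem_insert_of_mem hk) l
      (Finset.mem_insert_of_mem hl)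
    refine ⟨P.reflectionPerm a m', ?_⟩
    have h1 : P.pairing m' a = P.pairing m a := by
      have h2 := LinearMap.congr_fun hm' (corootV P a)
      simp only [LinearMap.sub_apply, LinearMap.coe_sum, Finset.sum_apply, LinearMap.smul_apply,
        rootFun_corootV, smul_eq_mul] at h2
      rw [Finset.sum_eq_zero, sub_zero] at h2
      · exact_mod_cast h2
      · intro l hl
        rw [hT l (Finset.mem_insert_of_mem hl) a (Finset.mem_insert_self a T)
          (fun h => ha (h ▸ hl))]
        simp
    rw [rootFun_reflectionPerm, h1, hm', Finset.sum_insert ha]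
    abel

/-- The reflection of the folded root system in a simple root. -/
lemma IsHighestIn.exists_reflection (hΘ : ∀ i, i ∈ b.support → Θ.indexEquiv i ∈ b.support)
    {i j : ι} (hi : i ∈ b.support) (hj : IsHighestIn P (orbit P Θ i) j) (m : ι) :
    ∃ m', restrictedRoot P Θ m' = restrictedRoot P Θ m -
      ((∑ l ∈ orbitFinset P Θ j, P.pairing m l : ℤ) : ℝ) • restrictedRoot P Θ j := by
  obtain ⟨m', hm'⟩ := exists_rootFun_eq_sub_sum (T := orbitFinset P Θ j) (fun k hk l hl =>
    hj.pairing_eq_zero hΘ hi ((mem_orbitFinset P Θ).1 hk) ((mem_orbitFinset P Θ).1 hl)) m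
  refine ⟨m', ?_⟩
  ext y
  rw [restrictedRoot_apply, hm']
  simp only [LinearMap.sub_apply, LinearMap.coe_sum, Finset.sum_apply, LinearMap.smul_apply,
    smul_eq_mul, restrictedRoot_apply]
  rw [Finset.sum_congr rfl fun l hl => by
    rw [rootFun_eq_of_mem_orbit y.2 ((mem_orbitFinset P Θ).1 hl)], ← Finset.sum_mul]
  push_cast
  rfl

/-- Positive long roots are sums of simple roots in the folded root system. -/
theorem restrictedRoot_mem_closure (hΘ : ∀ i, i ∈ b.support → Θ.indexEquiv i ∈ b.support)
    {m : ι} (hm : b.IsPos m) (hlong : IsLong P Θ m) :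
    restrictedRoot P Θ m ∈ AddSubmonoid.closure (foldedSimpleRoots P b Θ) := by
  obtain ⟨ρ, hρ, hρ1⟩ := exists_foldedRho b Θ hΘ
  obtain ⟨ω, hω1, hω⟩ := exists_foldedCoweights b Θ hΘ
  generalize hN : (b.height m).toNat = n
  induction n using Nat.strong_induction_on generalizing m with
  | _ n ih =>
  -- a simple root `i` in acute position to the orbit of `m`
  obtain ⟨i, hi, him⟩ : ∃ i ∈ b.support, 0 < ∑ l ∈ orbitFinset P Θ m, P.pairing i l := by
    -- Otherwise `m`, a sum of simple roots, would pair nonpositively with its own coroot sum.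
    by_contra! hcon
    have h1 : 0 ≤ rootFun P m (-corootSum P Θ m) := by
      refine rootFun_nonneg b (fun i hi => ?_) hm
      rw [map_neg, rootFun_corootSum, ← Int.cast_neg]
      exact Int.cast_nonneg (neg_nonneg.2 (hcon i hi))
    rw [map_neg, rootFun_corootSum] at h1
    have h2 : (0 : ℝ) < ((∑ j ∈ orbitFinset P Θ m, P.pairing m j : ℤ) : ℝ) :=
      Int.cast_pos.2 (sum_pairing_pos hΘ m)
    linarith
  obtain ⟨j, hj⟩ := exists_isHighestIn hΘ hi
  have hjm : restrictedRoot P Θ j ∈ foldedSimpleRoots P b Θ :=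
    mem_foldedSimpleRoots.2 ⟨i, hi, j, hj, rfl⟩
  obtain ⟨c, hc, hji⟩ := exists_restrictedRoot_eq_smul (hj.mem_closure hΘ hi)
    (restrictedRoot_ne_zero hΘ j)
  have hji' : ∀ y ∈ foldedSpace P Θ, rootFun P j y = c * rootFun P i y := fun y hy =>
    LinearMap.congr_fun hji ⟨y, hy⟩
  have hNpos : 0 < ∑ l ∈ orbitFinset P Θ j, P.pairing m l := by
    apply sum_pairing_pos_comm
    have h1 := hji' _ (corootSum_mem P Θ m)
    rw [rootFun_corootSum, rootFun_corootSum] at h1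
    have h2 : (0 : ℝ) < ((∑ l ∈ orbitFinset P Θ m, P.pairing i l : ℤ) : ℝ) := by exact_mod_cast him
    have h3 := mul_pos hc h2
    rw [← h1] at h3
    exact_mod_cast h3
  obtain ⟨m', hm'⟩ := hj.exists_reflection hΘ hi m
  set K := ∑ l ∈ orbitFinset P Θ j, P.pairing m l with hK
  have hm'y : ∀ y ∈ foldedSpace P Θ, rootFun P m' y = rootFun P m y - K * rootFun P j y :=
    fun y hy => LinearMap.congr_fun hm' ⟨y, hy⟩
  -- The reflection maps restricted roots to restricted roots: if `m'` were half of `l`, then `m`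
  -- would be half of the reflection of `l`.
  have hlong' : IsLong P Θ m' := by
    refine isLong_of_forall_half hΘ fun l hl => ?_
    obtain ⟨l', hl'⟩ := hj.exists_reflection hΘ hi l
    have h1 : ((∑ k ∈ orbitFinset P Θ j, P.pairing l k : ℤ) : ℝ) = -2 * K := by
      have h2 := LinearMap.congr_fun hl ⟨_, corootSum_mem P Θ j⟩
      simp only [restrictedRoot_apply, LinearMap.smul_apply, smul_eq_mul] at h2
      rw [hm'y _ (corootSum_mem P Θ j), rootFun_corootSum, rootFun_corootSum, rootFun_corootSum,
        hj.sum_pairing hΘ hi, ← hK] at h2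
      push_cast at h2 ⊢
      linarith
    refine hlong l' (1 / 2) (by norm_num) (by norm_num) ?_
    rw [hl', h1, smul_sub, ← hl, hm', smul_smul]
    module
  -- If the reflected root is positive, it has smaller height and induction applies. If it is
  -- negative, `m` is supported on the orbit of `i`, so it restricts to a multiple of `j`; both
  -- being long, the restrictions coincide.
  by_cases hpos : b.IsPos m'
  · have hjpos : 0 < b.height j := hj.isPos hΘ hi
    have hm'pos : 0 < b.height m' := hpos
    have hht : b.height m' = b.height m - K * b.height j := by
      have := hm'y ρ hρ
      rw [rootFun_eq_height b hρ1, rootFun_eq_height b hρ1, rootFun_eq_height b hρ1] at this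
      exact_mod_cast this
    have hlt : b.height m' < b.height m := by nlinarith
    have h1 := ih (b.height m').toNat (by omega) hpos hlong' rfl
    have h2 : restrictedRoot P Θ m = restrictedRoot P Θ m' + K.toNat • restrictedRoot P Θ j := by
      rw [hm', ← Nat.cast_smul_eq_nsmul ℝ]
      have : ((K.toNat : ℕ) : ℝ) = (K : ℝ) := by
        exact_mod_cast (Int.toNat_of_nonneg hNpos.le)
      rw [this]
      abel
    rw [h2]
    exact add_mem h1 (AddSubmonoid.nsmul_mem _ (AddSubmonoid.subset_closure hjm) _)
  · have hneg := (isPos_or_isPos_neg b m').resolve_left hpos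
    have hnn : ∀ k ∈ b.support, ∀ l ∈ b.support, 0 ≤ rootFun P l (ω k) := fun k hk l hl => by
      by_cases hlk : l ∈ orbit P Θ k
      · exact ((hω k hk l hl).1 hlk).le
      · exact ((hω k hk l hl).2 hlk).ge
    have hcl : P.root m ∈ AddSubmonoid.closure (P.root '' orbit P Θ i) := by
      refine root_mem_closure_orbit hω hm fun k hk hki => ?_
      have h1 := rootFun_nonneg b (hnn k hk) hneg
      have h2 := rootFun_nonneg b (hnn k hk) hm
      rw [rootFun_neg, LinearMap.neg_apply, hm'y _ (hω1 k), hji' _ (hω1 k), (hω k hk i hi).2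
        (fun h => hki (Equiv.Perm.SameCycle.symm h))] at h1
      linarith
    obtain ⟨c', hc', hmi⟩ := exists_restrictedRoot_eq_smul hcl (restrictedRoot_ne_zero hΘ m)
    have hmj : restrictedRoot P Θ m = (c' * c⁻¹) • restrictedRoot P Θ j := by
      rw [hji, hmi, smul_smul, mul_assoc, inv_mul_cancel₀ hc.ne', mul_one]
    rw [eq_one_of_isLong hlong (hj.isLong hΘ hi) (by positivity) hmj, one_smul] at hmj
    rw [hmj]
    exact AddSubmonoid.subset_closure hjm

/-- An integral combination of simple folded roots that is nonnegative at the folded fundamental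
coweights is a sum of simple folded roots. -/
lemma mem_closure_foldedSimpleRoots_of_nonneg
    (hΘ : ∀ i, i ∈ b.support → Θ.indexEquiv i ∈ b.support) {ω : ι → CoweightSpace N}
    (hω1 : ∀ i, ω i ∈ foldedSpace P Θ)
    (hω : ∀ i ∈ b.support, ∀ j ∈ b.support,
      (j ∈ orbit P Θ i → 0 < rootFun P j (ω i)) ∧ (j ∉ orbit P Θ i → rootFun P j (ω i) = 0))
    {f : Module.Dual ℝ (foldedSpace P Θ)}
    (hf : f ∈ Submodule.span ℤ (foldedSimpleRoots P b Θ))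
    (hnn : ∀ i ∈ b.support, 0 ≤ f ⟨ω i, hω1 i⟩) :
    f ∈ AddSubmonoid.closure (foldedSimpleRoots P b Θ) := by
  have hfin : (foldedSimpleRoots P b Θ).Finite :=
    (Set.finite_range (restrictedRoot P Θ)).subset fun f hf => by
      obtain ⟨-, -, j, -, rfl⟩ := mem_foldedSimpleRoots.1 hf
      exact ⟨j, rfl⟩
  have hcoe : foldedSimpleRoots P b Θ = (hfin.toFinset : Set (Module.Dual ℝ (foldedSpace P Θ))) :=
    hfin.coe_toFinset.symm
  rw [hcoe, Submodule.mem_span_finset] at hf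
  obtain ⟨n, -, rfl⟩ := hf
  refine AddSubmonoid.sum_mem _ fun g hg => ?_
  rw [Set.Finite.mem_toFinset] at hg
  obtain ⟨i, hi, j, hj, hgj⟩ := mem_foldedSimpleRoots.1 hg
  obtain ⟨c, hc, hji⟩ := exists_restrictedRoot_eq_smul (hj.mem_closure hΘ hi)
    (restrictedRoot_ne_zero hΘ j)
  have h1 := hnn i hi
  rw [LinearMap.coe_sum, Finset.sum_apply, Finset.sum_eq_single_of_mem g (by simpa using hg)] at h1
  · have h2 : 0 < g ⟨ω i, hω1 i⟩ := by
      rw [hgj, hji, LinearMap.smul_apply, smul_eq_mul, restrictedRoot_apply]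
      exact mul_pos hc ((hω i hi i hi).1 (self_mem_orbit P Θ i))
    rw [LinearMap.smul_apply, ← Int.cast_smul_eq_zsmul ℝ, smul_eq_mul] at h1
    have h3 : 0 ≤ n g := by exact_mod_cast nonneg_of_mul_nonneg_left h1 h2
    rw [← Int.toNat_of_nonneg h3, natCast_zsmul]
    exact AddSubmonoid.nsmul_mem _ (AddSubmonoid.subset_closure hg) _
  · intro g' hg' hne
    rw [Set.Finite.mem_toFinset] at hg'
    obtain ⟨i', hi', j', hj', hgj'⟩ := mem_foldedSimpleRoots.1 hg'
    obtain ⟨c', hc', hji'⟩ := exists_restrictedRoot_eq_smul (hj'.mem_closure hΘ hi')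
      (restrictedRoot_ne_zero hΘ j')
    -- Two folded simple roots from one orbit are proportional and long, hence equal. So `ω i` kills
    -- all folded simple roots but `g` and isolates its coefficient.
    have hi'i : i' ∉ orbit P Θ i := by
      intro hi'i
      apply hne
      rw [restrictedRoot_eq_of_mem_orbit P Θ hi'i] at hji'
      have h4 : restrictedRoot P Θ j' = (c' * c⁻¹) • restrictedRoot P Θ j := by
        rw [hji, hji', smul_smul, mul_assoc, inv_mul_cancel₀ hc.ne', mul_one]
      rw [eq_one_of_isLong (hj'.isLong hΘ hi') (hj.isLong hΘ hi) (by positivity) h4,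
        one_smul] at h4
      rw [hgj, hgj', h4]
    rw [LinearMap.smul_apply, hgj', hji', LinearMap.smul_apply, restrictedRoot_apply,
      (hω i hi i' hi').2 hi'i]
    simp

end Orbits

end FoldedBase

/-! ### The highest root -/

section Highest

variable {ι M N : Type*} [Finite ι] [AddCommGroup M] [AddCommGroup N]
  {P : RootDatum ι M N} {b : P.Base}

/-- A set of simple roots orthogonal to the other simple roots is empty or everything. -/
lemma IsIrreducibleDatum.simple_connected [P.IsReduced] (hP : IsIrreducibleDatum P) {J : Set ι}
    (hne : J.Nonempty)
    (horth : ∀ i ∈ J, ∀ k ∈ b.support, k ∉ J → P.pairing i k = 0) :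
    ∀ k ∈ b.support, k ∈ J := by
  cases nonempty_fintype ι
  have : Module.IsReflexive ℤ M := .of_isPerfPair P.toLinearMap
  set U := Submodule.span ℤ (P.root '' J) with hU
  set W := Submodule.span ℤ (P.root '' (b.support \ J)) with hW
  have hUk : ∀ k ∈ b.support, k ∉ J → ∀ u ∈ U, P.toLinearMap u (P.coroot k) = 0 := by
    intro k hk hkJ u hu
    induction hu using Submodule.span_induction with
    | mem x hx => obtain ⟨i, hi, rfl⟩ := hx; exact horth i hi k hk hkJ
    | zero => simp
    | add x y _ _ hx hy => rw [map_add, LinearMap.add_apply, hx, hy, add_zero]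
    | smul a x _ hx => rw [map_smul, LinearMap.smul_apply, hx, smul_zero]
  have hWk : ∀ k ∈ J, ∀ u ∈ W, P.toLinearMap u (P.coroot k) = 0 := by
    intro k hk u hu
    induction hu using Submodule.span_induction with
    | mem x hx =>
      obtain ⟨i, hi, rfl⟩ := hx
      exact P.pairing_eq_zero_iff.1 (horth k hk i hi.1 hi.2)
    | zero => simp
    | add x y _ _ hx hy => rw [map_add, LinearMap.add_apply, hx, hy, add_zero]
    | smul a x _ hx => rw [map_smul, LinearMap.smul_apply, hx, smul_zero]
  -- Every root is reached from simple ones by simple reflections. A reflection in a root of `J`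
  -- preserves `U` and fixes `W`, and one in a simple root outside `J` does the opposite.
  have hUW : ∀ m, P.root m ∈ U ∨ P.root m ∈ W := by
    intro m
    refine b.induction_reflect m (p := fun m => P.root m ∈ U ∨ P.root m ∈ W) ?_ ?_ ?_
    · intro i hi
      rw [P.root_reflectionPerm, P.reflection_apply_self]
      exact hi.imp U.neg_mem W.neg_mem
    · intro i hi
      by_cases hiJ : i ∈ J
      · exact Or.inl (Submodule.subset_span ⟨i, hiJ, rfl⟩)
      · exact Or.inr (Submodule.subset_span ⟨i, ⟨hi, hiJ⟩, rfl⟩)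
    · intro i j hi hj
      rw [← P.reflectionPerm_root]
      by_cases hjJ : j ∈ J
      · rcases hi with hi | hi
        · exact Or.inl (U.sub_mem hi (U.smul_mem _ (Submodule.subset_span ⟨j, hjJ, rfl⟩)))
        · rw [hWk j hjJ _ hi, zero_smul, sub_zero]
          exact Or.inr hi
      · rcases hi with hi | hi
        · rw [hUk j hj hjJ _ hi, zero_smul, sub_zero]
          exact Or.inl hi
        · exact Or.inr (W.sub_mem hi (W.smul_mem _ (Submodule.subset_span ⟨j, ⟨hj, hjJ⟩, rfl⟩)))
  have hform : ∀ u ∈ U, ∀ v ∈ W, P.RootForm u v = 0 := by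
    intro u hu v hv
    induction hu using Submodule.span_induction with
    | mem x hx =>
      obtain ⟨i, hi, rfl⟩ := hx
      induction hv using Submodule.span_induction with
      | mem x hx =>
        obtain ⟨k, hk, rfl⟩ := hx
        exact (P.toInvariantForm.apply_root_root_zero_iff i k).2 (horth i hi k hk.1 hk.2)
      | zero => simp
      | add x y _ _ hx hy => rw [map_add, hx, hy, add_zero]
      | smul a x _ hx => rw [map_smul, hx, smul_zero]
    | zero => simp
    | add x y _ _ hx hy => rw [map_add, LinearMap.add_apply, hx, hy, add_zero]
    | smul a x _ hx => rw [map_smul, LinearMap.smul_apply, hx, smul_zero]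
  have huniv : {m | P.root m ∈ U} = Set.univ := by
    refine (hP.2 {m | P.root m ∈ U} fun i hi j hj => ?_).resolve_left ?_
    · have h1 := (P.toInvariantForm.apply_root_root_zero_iff i j).1
        (hform _ hi _ ((hUW j).resolve_left hj))
      exact ⟨h1, P.pairing_eq_zero_iff.1 h1⟩
    · obtain ⟨i, hi⟩ := hne
      exact Set.Nonempty.ne_empty ⟨i, Submodule.subset_span ⟨i, hi, rfl⟩⟩
  -- All roots now lie in `U`, so a simple root outside `J` would have pairing zero with its own
  -- coroot.
  intro k hk
  by_contra hkJ
  have h1 : P.root k ∈ U := by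
    have : k ∈ {m | P.root m ∈ U} := by rw [huniv]; trivial
    exact this
  have h2 := hUk k hk hkJ _ h1
  rw [P.root_coroot_two] at h2
  norm_num at h2

/-- A root of maximal height is dominant, and irreducibility makes all its coefficients positive. A
positive root below it either can be raised by a simple root or is dominant; in the second case it
pairs positively with the highest root, and their difference is a positive root. -/
lemma exists_highestRoot [P.IsReduced] [Module.Finite ℤ N] (hP : IsIrreducibleDatum P) (b : P.Base) :
    ∃ θ, b.IsPos θ ∧ (∀ m, b.height m ≤ b.height θ) ∧
      ∀ m, P.root θ - P.root m ∈ AddSubmonoid.closure (P.root '' b.support) := by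
  cases nonempty_fintype ι
  have : Nonempty ι := hP.1
  obtain ⟨θ, hmax⟩ := Finite.exists_max b.height
  have hpos : b.IsPos θ := by
    obtain ⟨i, hi⟩ := b.support_nonempty
    have h1 := hmax i
    rw [b.height_one_of_mem_support hi] at h1
    rw [RootPairing.Base.isPos_iff]
    omega
  have hraise : ∀ m i, b.IsPos m → b.IsPos i → P.pairing m i < 0 →
      ∃ k, P.root k = P.root m + P.root i := by
    intro m i hm hi h
    obtain ⟨k, hk⟩ := P.root_add_root_mem_of_pairingIn_neg (i := m) (j := i)
      (by rwa [pairingIn_int]) (by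
        intro h
        have h' : P.reflectionPerm i i = m := rootFun_injective P (by
          rw [rootFun_neg, ← weightFun_root, ← weightFun_root, h, map_neg])
        exact not_isPos_neg hi (h' ▸ hm))
    exact ⟨k, hk⟩
  have hdom : ∀ i, b.IsPos i → 0 ≤ P.pairing θ i := by
    intro i hi
    by_contra! h
    obtain ⟨k, hk⟩ := hraise θ i hpos hi h
    have h1 := b.height_add hk
    have h2 := hmax k
    have h3 : 0 < b.height i := hi
    omega
  obtain ⟨f, hf⟩ : ∃ f : ι → ℕ, P.root θ = ∑ k ∈ b.support, f k • P.root k := by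
    classical
    have hm' := (isPos_iff_mem_closure b).1 hpos
    rw [← Submodule.span_nat_eq_addSubmonoidClosure, Submodule.mem_toAddSubmonoid,
      Submodule.mem_span_image_finset_iff_exists_fun] at hm'
    obtain ⟨f, hf⟩ := hm'
    refine ⟨fun k => if hk : k ∈ b.support then f ⟨k, hk⟩ else 0, ?_⟩
    rw [← hf, ← Finset.sum_coe_sort b.support]
    exact Finset.sum_congr rfl fun k _ => by simp
  have hfpos : ∀ k ∈ b.support, 0 < f k := by
    -- For a simple root `k` outside the support of `θ`, the pairing of `θ` with `k` is nonnegative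
    -- by dominance but is a sum of nonpositive terms. Every term vanishes, so the support is
    -- orthogonal to the remaining simple roots.
    have hconn := hP.simple_connected (b := b) (J := {k | k ∈ b.support ∧ 0 < f k})
      (by
        by_contra hempty
        rw [Set.not_nonempty_iff_eq_empty] at hempty
        refine P.ne_zero θ ?_
        rw [hf]
        refine Finset.sum_eq_zero fun k hk => ?_
        have : k ∉ {k | k ∈ b.support ∧ 0 < f k} := by rw [hempty]; simp
        have h0 : f k = 0 := by
          by_contra h
          exact this ⟨hk, Nat.pos_of_ne_zero h⟩
        rw [h0, zero_smul]) (by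
        intro i hi k hk hkJ
        have hsum : P.pairing θ k = ∑ l ∈ b.support, (f l : ℤ) * P.pairing l k := by
          rw [← P.root_coroot_eq_pairing, hf, map_sum, LinearMap.coe_sum, Finset.sum_apply]
          refine Finset.sum_congr rfl fun l _ => ?_
          rw [map_nsmul, LinearMap.smul_apply, nsmul_eq_mul]
          rfl
        have hterm : ∀ l ∈ b.support, (f l : ℤ) * P.pairing l k ≤ 0 := by
          intro l hl
          by_cases hlk : l = k
          · subst hlk
            have h0 : f l = 0 := by
              by_contra h
              exact hkJ ⟨hl, Nat.pos_of_ne_zero h⟩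
            simp [h0]
          · refine mul_nonpos_of_nonneg_of_nonpos (by positivity) ?_
            have := b.pairingIn_le_zero_of_ne hlk hl hk
            rwa [pairingIn_int] at this
        have h0 := le_antisymm (hsum ▸ Finset.sum_nonpos hterm)
          (hdom k (RootPairing.Base.isPos_of_mem_support hk))
        rw [hsum, Finset.sum_eq_zero_iff_of_nonpos hterm] at h0
        have h1 := h0 i hi.1
        have h2 : (f i : ℤ) ≠ 0 := by exact_mod_cast hi.2.ne'
        exact (mul_eq_zero.1 h1).resolve_left h2)
    exact fun k hk => (hconn k hk).2
  refine ⟨θ, hpos, hmax, fun m => ?_⟩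
  -- induction from above on the height
  obtain ⟨n, hn⟩ : ∃ n : ℕ, b.height θ - b.height m = n :=
    ⟨_, (Int.toNat_of_nonneg (by have := hmax m; omega)).symm⟩
  induction n using Nat.strong_induction_on generalizing m with
  | _ n ih =>
  have hθcl := (isPos_iff_mem_closure b).1 hpos
  by_cases hm : b.IsPos m
  swap
  · have hneg := (isPos_iff_mem_closure b).1 ((isPos_or_isPos_neg b m).resolve_left hm)
    rw [P.root_reflectionPerm, P.reflection_apply_self] at hneg
    rw [sub_eq_add_neg]
    exact add_mem hθcl hneg
  by_cases hup : ∃ i ∈ b.support, P.pairing m i < 0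
  · obtain ⟨i, hi, hneg⟩ := hup
    obtain ⟨k, hk⟩ := hraise m i hm (RootPairing.Base.isPos_of_mem_support hi) hneg
    have h1 := b.height_add hk
    rw [b.height_one_of_mem_support hi] at h1
    have h2 := hmax k
    have h3 := ih (b.height θ - b.height k).toNat (by omega) k (by omega)
    have h4 : P.root θ - P.root m = (P.root θ - P.root k) + P.root i := by rw [hk]; abel
    rw [h4]
    exact add_mem h3 (AddSubmonoid.subset_closure (Set.mem_image_of_mem _ hi))
  · push Not at hup
    by_cases hmθ : θ = m
    · rw [hmθ, sub_self]
      exact zero_mem _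
    have hform : 0 < P.RootForm (P.root m) (P.root θ) := by
      have h1 : 2 * P.RootForm (P.root m) (P.root θ) = ∑ k ∈ b.support,
          (f k : ℤ) * (P.pairing m k * P.RootForm (P.root k) (P.root k)) := by
        rw [hf, map_sum, Finset.mul_sum]
        refine Finset.sum_congr rfl fun k _ => ?_
        have h3 := P.toInvariantForm.two_mul_apply_root_root m k
        simp only [RootPairing.toInvariantForm_form] at h3
        rw [map_nsmul, nsmul_eq_mul, ← h3]
        ring
      -- A positive root has positive pairing with some simple root, and the coefficient of that
      -- simple root in `θ` is positive.
      obtain ⟨i, hi, hmi⟩ := hm.exists_mem_support_pos_pairingIn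
      rw [P.zero_lt_pairingIn_iff', pairingIn_int] at hmi
      have h2 : 0 < 2 * P.RootForm (P.root m) (P.root θ) := by
        rw [h1]
        refine Finset.sum_pos' (fun k hk => ?_) ⟨i, hi, ?_⟩
        · have := hup k hk
          have := (rootForm_root_self_pos (P := P) k).le
          positivity
        · have := hfpos i hi
          have := rootForm_root_self_pos (P := P) i
          positivity
      omega
    have hpair : 0 < P.pairing m θ := by
      have h3 := P.toInvariantForm.two_mul_apply_root_root m θ
      simp only [RootPairing.toInvariantForm_form] at h3
      exact pos_of_mul_pos_left (by rw [← h3]; omega) (rootForm_root_self_pos (P := P) θ).le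
    obtain ⟨k, hk⟩ := P.root_sub_root_mem_of_pairingIn_pos (i := θ) (j := m)
      (by rw [P.zero_lt_pairingIn_iff']; rwa [pairingIn_int]) hmθ
    rw [← hk]
    refine (isPos_iff_mem_closure b).1 ?_
    rw [RootPairing.Base.isPos_iff']
    have h1 := b.height_sub hk
    have h2 := hmax m
    omega

end Highest

/-! ### Base alcoves -/

section BaseAlcoves

variable {ι M N : Type*} [Finite ι] [AddCommGroup M] [AddCommGroup N] [Module.Finite ℤ N]
  {P : RootDatum ι M N} {b : P.Base} {Θ : P.Aut}

omit [Finite ι] in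
lemma mem_positiveRoots_iff {f : Module.Dual ℝ (CoweightSpace N)} :
    f ∈ positiveRoots (roots P) (simpleRoots P b) ↔ ∃ i, b.IsPos i ∧ f = rootFun P i := by
  constructor
  · rintro ⟨⟨i, rfl⟩, hi⟩
    exact ⟨i, (isPos_iff_mem_closure b).2 (weightFun_mem_closure_iff.1 hi), rfl⟩
  · rintro ⟨i, hi, rfl⟩
    exact ⟨⟨i, rfl⟩, weightFun_mem_closure_iff.2 ((isPos_iff_mem_closure b).1 hi)⟩

lemma foldedSimpleRoot_eq (hΘ : ∀ i, i ∈ b.support → Θ.indexEquiv i ∈ b.support)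
    {f : Module.Dual ℝ (foldedSpace P Θ)} (hf : f ∈ foldedSimpleRoots P b Θ) :
    ∃ i ∈ b.support, ∃ c : ℝ, 0 < c ∧ f = c • restrictedRoot P Θ i := by
  obtain ⟨i, hi, j, hj, rfl⟩ := mem_foldedSimpleRoots.1 hf
  obtain ⟨c, hc, h⟩ := exists_restrictedRoot_eq_smul (hj.mem_closure hΘ hi)
    (restrictedRoot_ne_zero hΘ j)
  exact ⟨i, hi, c, hc, h⟩

lemma exists_foldedSimpleRoot (hΘ : ∀ i, i ∈ b.support → Θ.indexEquiv i ∈ b.support)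
    {i : ι} (hi : i ∈ b.support) :
    ∃ f ∈ foldedSimpleRoots P b Θ, ∃ c : ℝ, 0 < c ∧ f = c • restrictedRoot P Θ i := by
  obtain ⟨j, hj⟩ := exists_isHighestIn hΘ hi
  obtain ⟨c, hc, h⟩ := exists_restrictedRoot_eq_smul (hj.mem_closure hΘ hi)
    (restrictedRoot_ne_zero hΘ j)
  exact ⟨_, mem_foldedSimpleRoots.2 ⟨i, hi, j, hj, rfl⟩, c, hc, h⟩

lemma nonneg_of_mem_closure {E : Type*} [AddCommGroup E] [Module ℝ E]
    {Δ : Set (Module.Dual ℝ E)} {x : E} (hx : ∀ α ∈ Δ, 0 ≤ α x)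
    {f : Module.Dual ℝ E} (hf : f ∈ AddSubmonoid.closure Δ) : 0 ≤ f x := by
  induction hf using AddSubmonoid.closure_induction with
  | mem y hy => exact hx y hy
  | zero => exact le_rfl
  | add y z _ _ hy hz => exact add_nonneg hy hz

lemma mem_foldedPositiveRoots_iff (hΘ : ∀ i, i ∈ b.support → Θ.indexEquiv i ∈ b.support)
    {f : Module.Dual ℝ (foldedSpace P Θ)} :
    f ∈ positiveRoots (foldedRoots P Θ) (foldedSimpleRoots P b Θ) ↔
      ∃ i, b.IsPos i ∧ IsLong P Θ i ∧ f = restrictedRoot P Θ i := by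
  constructor
  · rintro ⟨hf, hcl⟩
    obtain ⟨i, hi, rfl⟩ := (mem_foldedRoots P Θ).1 hf
    refine ⟨i, ?_, hi, rfl⟩
    obtain ⟨ρ, hρ, hρ1⟩ := exists_foldedRho b Θ hΘ
    have h := nonneg_of_mem_closure (x := ⟨ρ, hρ⟩) (fun α hα => by
      obtain ⟨j, hj, c, hc, rfl⟩ := foldedSimpleRoot_eq hΘ hα
      rw [LinearMap.smul_apply, restrictedRoot_apply, hρ1 j hj, smul_eq_mul, mul_one]
      exact hc.le) hcl
    rw [restrictedRoot_apply, rootFun_eq_height b hρ1] at h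
    rw [RootPairing.Base.isPos_iff']
    exact_mod_cast h
  · rintro ⟨i, hpos, hi, rfl⟩
    exact ⟨(mem_foldedRoots P Θ).2 ⟨i, hi, rfl⟩, restrictedRoot_mem_closure hΘ hpos hi⟩

omit [Finite ι] [Module.Finite ℤ N] in
lemma isLong_neg {i : ι} (hi : IsLong P Θ i) : IsLong P Θ (P.reflectionPerm i i) := by
  intro j c h0 h1 h
  refine hi (P.reflectionPerm j j) c h0 h1 ?_
  ext y
  have h2 := LinearMap.congr_fun h y
  simp only [restrictedRoot_apply, rootFun_neg, LinearMap.neg_apply, LinearMap.smul_apply,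
    smul_eq_mul] at h2 ⊢
  linarith

/-- The restriction of the highest root is the highest root of the folded root system. -/
lemma isHighestRoot_restrictedRoot (hΘ : ∀ i, i ∈ b.support → Θ.indexEquiv i ∈ b.support)
    {θ : ι} (hpos : b.IsPos θ) (hmax : ∀ m, b.height m ≤ b.height θ)
    (hθ : ∀ m, P.root θ - P.root m ∈ AddSubmonoid.closure (P.root '' b.support)) :
    IsHighestRoot (foldedRoots P Θ) (foldedSimpleRoots P b Θ) (restrictedRoot P Θ θ) := by
  obtain ⟨ρ, hρ, hρ1⟩ := exists_foldedRho b Θ hΘ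
  obtain ⟨ω, hω1, hω⟩ := exists_foldedCoweights b Θ hΘ
  have hlong : IsLong P Θ θ := by
    -- A root whose restriction is twice that of `θ` would have twice its height.
    refine isLong_of_forall_half hΘ fun j hj => ?_
    have h1 := LinearMap.congr_fun hj ⟨ρ, hρ⟩
    simp only [restrictedRoot_apply, LinearMap.smul_apply, smul_eq_mul,
      rootFun_eq_height b hρ1] at h1
    have h2 : (b.height j : ℝ) ≤ b.height θ := by exact_mod_cast hmax j
    have h3 : (0 : ℝ) < b.height θ := by exact_mod_cast hpos
    linarith
  have hspan : ∀ m, IsLong P Θ m →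
      restrictedRoot P Θ m ∈ Submodule.span ℤ (foldedSimpleRoots P b Θ) := by
    have hp : ∀ m, b.IsPos m → IsLong P Θ m →
        restrictedRoot P Θ m ∈ Submodule.span ℤ (foldedSimpleRoots P b Θ) := fun m h1 h2 =>
      (AddSubmonoid.closure_le (S := (Submodule.span ℤ
        (foldedSimpleRoots P b Θ)).toAddSubmonoid)).2 Submodule.subset_span
        (restrictedRoot_mem_closure hΘ h1 h2)
    intro m hm
    rcases isPos_or_isPos_neg b m with h | h
    · exact hp m h hm
    · have h1 := hp _ h (isLong_neg hm)
      have h2 : restrictedRoot P Θ m = -restrictedRoot P Θ (P.reflectionPerm m m) := by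
        ext y
        simp [rootFun_neg]
      rw [h2]
      exact Submodule.neg_mem _ h1
  refine ⟨(mem_foldedRoots P Θ).2 ⟨θ, hlong, rfl⟩, fun β hβ => ?_⟩
  obtain ⟨m, hm, rfl⟩ := (mem_foldedRoots P Θ).1 hβ
  -- The difference is an integral combination of folded simple roots; it is nonnegative at the
  -- folded coweights because `θ - m` is a sum of simple roots.
  refine mem_closure_foldedSimpleRoots_of_nonneg hΘ hω1 hω
    (Submodule.sub_mem _ (hspan θ hlong) (hspan m hm)) fun i hi => ?_
  have h1 := weightFun_nonneg (x := ω i) (fun j hj => by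
    by_cases hji : j ∈ orbit P Θ i
    · exact ((hω i hi j hj).1 hji).le
    · exact ((hω i hi j hj).2 hji).ge) (hθ m)
  rw [map_sub] at h1
  exact h1

/-- Folded simple roots are positive multiples of restricted simple roots, with every orbit
represented, so the dominant chambers correspond; the highest roots correspond by restriction. -/
lemma baseAlcove_folded [P.IsReduced] (hP : IsIrreducibleDatum P)
    (hΘ : ∀ i, i ∈ b.support → Θ.indexEquiv i ∈ b.support) :
    baseAlcove (foldedRoots P Θ) (foldedSimpleRoots P b Θ) =
      interFolded P Θ (baseAlcove (roots P) (simpleRoots P b)) := by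
  obtain ⟨θ, hpos, hmax, hθ⟩ := exists_highestRoot hP b
  have hhigh : IsHighestRoot (roots P) (simpleRoots P b) (rootFun P θ) := by
    refine ⟨⟨θ, rfl⟩, ?_⟩
    rintro _ ⟨m, rfl⟩
    rw [← weightFun_root, ← weightFun_root, ← map_sub]
    exact weightFun_mem_closure_iff.2 (hθ m)
  have hhigh' := isHighestRoot_restrictedRoot hΘ hpos hmax hθ
  ext y
  have hdom : y ∈ dominantChamber (foldedSimpleRoots P b Θ) ↔
      (y : CoweightSpace N) ∈ dominantChamber (simpleRoots P b) := by
    constructor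
    · rintro hy _ ⟨i, hi, rfl⟩
      obtain ⟨f, hf, c, hc, rfl⟩ := exists_foldedSimpleRoot hΘ hi
      have := hy _ hf
      rw [LinearMap.smul_apply, smul_eq_mul] at this
      exact pos_of_mul_pos_right this hc.le
    · intro hy f hf
      obtain ⟨i, hi, c, hc, rfl⟩ := foldedSimpleRoot_eq hΘ hf
      exact mul_pos hc (hy _ ⟨i, hi, rfl⟩)
  constructor
  · rintro ⟨hy, θ', ⟨-, hθ'2⟩, hlt⟩
    refine ⟨hdom.1 hy, rootFun P θ, hhigh, ?_⟩
    -- The base alcove allows any functional with the highest root property; on the dominant chamber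
    -- each such functional dominates all roots, so the bound passes to the chosen one.
    have h := nonneg_of_mem_closure (fun α hα => (hy α hα).le) (hθ'2 _ hhigh'.1)
    rw [LinearMap.sub_apply, restrictedRoot_apply] at h
    linarith
  · rintro ⟨hy, θ', ⟨-, hθ'2⟩, hlt⟩
    refine ⟨hdom.2 hy, restrictedRoot P Θ θ, hhigh', ?_⟩
    have h := nonneg_of_mem_closure (fun α hα => (hy α hα).le) (hθ'2 _ hhigh.1)
    rw [LinearMap.sub_apply] at h
    rw [restrictedRoot_apply]
    linarith

/-- On the dominant chamber positive roots are positive and bounded by the highest root. -/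
lemma mem_baseAlcove_iff [P.IsReduced] (hP : IsIrreducibleDatum P) {y : CoweightSpace N} :
    y ∈ baseAlcove (roots P) (simpleRoots P b) ↔
      ∀ m, b.IsPos m → 0 < rootFun P m y ∧ rootFun P m y < 1 := by
  obtain ⟨θ, hpos, -, hθ⟩ := exists_highestRoot hP b
  have hle : ∀ m, rootFun P θ - rootFun P m ∈ AddSubmonoid.closure (simpleRoots P b) := by
    intro m
    rw [← weightFun_root, ← weightFun_root, ← map_sub]
    exact weightFun_mem_closure_iff.2 (hθ m)
  constructor
  · rintro ⟨hy, θ', ⟨-, hθ'2⟩, hlt⟩ m hm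
    constructor
    · have : ∀ m ∈ AddSubmonoid.closure (P.root '' b.support), m = 0 ∨ 0 < weightFun P m y := by
        intro m hm
        induction hm using AddSubmonoid.closure_induction with
        | mem z hz =>
          obtain ⟨i, hi, rfl⟩ := hz
          exact Or.inr (hy _ ⟨i, hi, rfl⟩)
        | zero => exact Or.inl rfl
        | add u v _ _ hu hv =>
          rw [map_add, LinearMap.add_apply]
          rcases hu with rfl | hu
          · simpa using hv
          · rcases hv with rfl | hv
            · right; simpa using hu
            · right; linarith
      exact (this _ ((isPos_iff_mem_closure b).1 hm)).resolve_left (P.ne_zero m)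
    · have h := nonneg_of_mem_closure (fun α hα => (hy α hα).le) (hθ'2 _ ⟨m, rfl⟩)
      rw [LinearMap.sub_apply] at h
      linarith
  · intro h
    refine ⟨?_, rootFun P θ, ⟨⟨θ, rfl⟩, ?_⟩, (h θ hpos).2⟩
    · rintro _ ⟨i, hi, rfl⟩
      exact (h i (RootPairing.Base.isPos_of_mem_support hi)).1
    · rintro _ ⟨m, rfl⟩
      exact hle m

/-- The base alcove is an alcove, and it contains a point of the folded space. -/
lemma exists_baseAlcove_eq_floorCell [P.IsReduced] (hP : IsIrreducibleDatum P)
    (hΘ : ∀ i, i ∈ b.support → Θ.indexEquiv i ∈ b.support) :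
    ∃ x : foldedSpace P Θ, (x : CoweightSpace N) ∈ regularSet (roots P) ∧
      baseAlcove (roots P) (simpleRoots P b) = floorCell (roots P) x := by
  obtain ⟨θ, hpos, hmax, hθ⟩ := exists_highestRoot hP b
  obtain ⟨ρ, hρ, hρ1⟩ := exists_foldedRho b Θ hΘ
  have hc : (0 : ℝ) < b.height θ + 1 := by
    have : (0 : ℝ) < b.height θ := by exact_mod_cast hpos
    linarith
  -- At `ρ / (height θ + 1)` a positive root takes the value `height / (height θ + 1)`, strictly
  -- between 0 and 1.
  let x : foldedSpace P Θ := ((b.height θ : ℝ) + 1)⁻¹ • ⟨ρ, hρ⟩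
  have hx : ∀ m, b.IsPos m → 0 < rootFun P m x ∧ rootFun P m x < 1 := by
    intro m hm
    have h1 : rootFun P m x = ((b.height θ : ℝ) + 1)⁻¹ * b.height m := by
      simp [x, rootFun_eq_height b hρ1]
    have h2 : (0 : ℝ) < b.height m := by exact_mod_cast hm
    have h3 : (b.height m : ℝ) ≤ b.height θ := by exact_mod_cast hmax m
    rw [h1]
    refine ⟨by positivity, ?_⟩
    rw [inv_mul_lt_iff₀ hc]
    linarith
  have hfl : ∀ m, b.IsPos m → ⌊rootFun P m x⌋ = 0 := fun m hm =>
    Int.floor_eq_zero_iff.2 ⟨(hx m hm).1.le, (hx m hm).2⟩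
  have hneg : ∀ (m : ι) (y : CoweightSpace N),
      rootFun P (P.reflectionPerm m m) y = -rootFun P m y := fun m y => by
    rw [rootFun_neg, LinearMap.neg_apply]
  have hfln : ∀ m, b.IsPos (P.reflectionPerm m m) → ⌊rootFun P m x⌋ = -1 := fun m hm => by
    have h := hx _ hm
    rw [hneg] at h
    rw [Int.floor_eq_iff]
    push_cast
    constructor <;> linarith [h.1, h.2]
  have hcell : ∀ y, y ∈ floorCell (roots P) x ↔
      ∀ m, b.IsPos m → 0 < rootFun P m y ∧ rootFun P m y < 1 := by
    intro y
    rw [mem_floorCell_iff]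
    constructor
    · intro h m hm
      have := h _ ⟨m, rfl⟩
      rw [hfl m hm] at this
      simpa using this
    · rintro h _ ⟨m, rfl⟩
      rcases isPos_or_isPos_neg b m with hm | hm
      · rw [hfl m hm]
        simpa using h m hm
      · rw [hfln m hm]
        have := h _ hm
        rw [hneg] at this
        push_cast
        constructor <;> linarith [this.1, this.2]
  refine ⟨x, ((hcell x).2 hx).1, ?_⟩
  ext y
  rw [mem_baseAlcove_iff hP, hcell]

end BaseAlcoves

/-! ### Alcoves of the folded space -/

section FoldedCells

/-- An integer `n` satisfies `n ≤ u/2` if and only if `2n ≤ ⌊u⌋`. This is why roots of half length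
add neither walls nor conditions on cones. -/
lemma floor_half_le {u v : ℝ} (h : ⌊u⌋ ≤ ⌊v⌋) : ⌊(1 / 2 : ℝ) * u⌋ ≤ ⌊(1 / 2 : ℝ) * v⌋ := by
  rw [Int.le_floor]
  have h1 : (⌊(1 / 2 : ℝ) * u⌋ : ℝ) ≤ 1 / 2 * u := Int.floor_le _
  have h2 : 2 * ⌊(1 / 2 : ℝ) * u⌋ ≤ ⌊u⌋ := by
    rw [Int.le_floor]
    push_cast
    linarith
  have h3 : ((2 * ⌊(1 / 2 : ℝ) * u⌋ : ℤ) : ℝ) ≤ ⌊v⌋ := by exact_mod_cast h2.trans h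
  have h4 := Int.floor_le v
  push_cast at h3
  linarith

variable {ι M N : Type*} [Finite ι] [AddCommGroup M] [AddCommGroup N] [Module.Finite ℤ N]
  {P : RootDatum ι M N} {b : P.Base} {Θ : P.Aut}

/-- A discarded restriction is half of a long one, `β`, and `H_{β/2,k} = H_{β,2k}`. -/
lemma mem_regularSet_folded (hΘ : ∀ i, i ∈ b.support → Θ.indexEquiv i ∈ b.support)
    {x : foldedSpace P Θ} :
    x ∈ regularSet (foldedRoots P Θ) ↔ (x : CoweightSpace N) ∈ regularSet (roots P) := by
  rw [mem_regularSet, mem_regularSet]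
  constructor
  · rintro h _ ⟨i, rfl⟩ k hk
    by_cases hi : IsLong P Θ i
    · exact h _ ((mem_foldedRoots P Θ).2 ⟨i, hi, rfl⟩) k hk
    · obtain ⟨j, hj, hij⟩ := exists_isLong hΘ hi
      have h1 := LinearMap.congr_fun hij x
      simp only [restrictedRoot_apply, LinearMap.smul_apply, smul_eq_mul] at h1
      refine h _ ((mem_foldedRoots P Θ).2 ⟨j, hj, rfl⟩) (2 * k) ?_
      rw [restrictedRoot_apply]
      push_cast
      linarith
  · rintro h f hf k hk
    obtain ⟨i, -, rfl⟩ := (mem_foldedRoots P Θ).1 hf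
    exact h _ ⟨i, rfl⟩ k hk

omit [Finite ι] [Module.Finite ℤ N] in
lemma floor_le_of_eq_half
    {x y : foldedSpace P Θ} {i j : ι}
    (hij : restrictedRoot P Θ i = (1 / 2 : ℝ) • restrictedRoot P Θ j)
    (h : ⌊rootFun P j x⌋ ≤ ⌊rootFun P j y⌋) : ⌊rootFun P i x⌋ ≤ ⌊rootFun P i y⌋ := by
  have h1 : ∀ z : foldedSpace P Θ, rootFun P i z = (1 / 2 : ℝ) * rootFun P j z := fun z =>
    LinearMap.congr_fun hij z
  rw [h1, h1]
  exact floor_half_le h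

/-- Integer parts of the discarded restrictions are determined by those of the long ones, so
imposing them adds nothing. -/
lemma interFolded_floorCell (hΘ : ∀ i, i ∈ b.support → Θ.indexEquiv i ∈ b.support)
    (x : foldedSpace P Θ) :
    interFolded P Θ (floorCell (roots P) x) = floorCell (foldedRoots P Θ) x := by
  ext y
  constructor
  · rintro ⟨hy, h⟩
    refine ⟨(mem_regularSet_folded hΘ).2 hy, fun f hf => ?_⟩
    obtain ⟨i, -, rfl⟩ := (mem_foldedRoots P Θ).1 hf
    exact h _ ⟨i, rfl⟩
  · rintro ⟨hy, h⟩
    refine ⟨(mem_regularSet_folded hΘ).1 hy, ?_⟩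
    rintro _ ⟨i, rfl⟩
    by_cases hi : IsLong P Θ i
    · exact h _ ((mem_foldedRoots P Θ).2 ⟨i, hi, rfl⟩)
    · obtain ⟨j, hj, hij⟩ := exists_isLong hΘ hi
      have h1 := h _ ((mem_foldedRoots P Θ).2 ⟨j, hj, rfl⟩)
      exact le_antisymm (floor_le_of_eq_half hij h1.le) (floor_le_of_eq_half hij h1.ge)

instance : ContinuousAdd (foldedSpace P Θ) := (foldedSpace P Θ).toAddSubmonoid.continuousAdd

omit [Finite ι] in
lemma continuous_of_mem_roots : ∀ α ∈ roots P, Continuous α := fun α _ => continuous_dual α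

lemma continuous_of_mem_foldedRoots : ∀ α ∈ foldedRoots P Θ, Continuous α := by
  intro α hα
  obtain ⟨i, -, rfl⟩ := (mem_foldedRoots P Θ).1 hα
  exact (continuous_dual (rootFun P i)).comp continuous_subtype_val

end FoldedCells

/-! ### The Weyl group -/

section Weyl

variable {ι M N : Type*} [AddCommGroup M] [AddCommGroup N]
  {P : RootDatum ι M N} {b : P.Base} {Θ : P.Aut}

/-- The Weyl group permutes the roots. -/
lemma exists_perm_of_mem_weylGroupV {w : CoweightSpace N ≃ₗ[ℝ] CoweightSpace N}
    (hw : w ∈ weylGroupV P) : ∃ τ : Equiv.Perm ι, ∀ i x, rootFun P (τ i) (w x) = rootFun P i x := by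
  induction hw using Subgroup.closure_induction with
  | mem w hw =>
    obtain ⟨j, rfl⟩ := hw
    exact ⟨P.reflectionPerm j, fun i x => rootFun_reflectionV P i j x⟩
  | one => exact ⟨1, fun i x => rfl⟩
  | mul u v _ _ hu hv =>
    obtain ⟨τ, hτ⟩ := hu
    obtain ⟨τ', hτ'⟩ := hv
    exact ⟨τ * τ', fun i x => (hτ _ _).trans (hτ' _ _)⟩
  | inv u _ hu =>
    obtain ⟨τ, hτ⟩ := hu
    refine ⟨τ⁻¹, fun i x => ?_⟩
    rw [← hτ]
    exact congrArg₂ (fun j y => rootFun P j y) (τ.apply_symm_apply i) (u.apply_symm_apply x)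

/-- Elements of the fixed-point subgroup preserve the folded space. -/
lemma map_mem_foldedSpace [Finite ι] {w : CoweightSpace N ≃ₗ[ℝ] CoweightSpace N}
    (hw : w ∈ fixedWeylGroup P Θ) {x : CoweightSpace N} (hx : x ∈ foldedSpace P Θ) :
    w x ∈ foldedSpace P Θ := by
  obtain ⟨τ, hτ⟩ := exists_perm_of_mem_weylGroupV hw.1
  have hcomm : autV P Θ * w = w * autV P Θ := Subgroup.mem_centralizer_iff.1 hw.2 _ rfl
  rw [mem_foldedSpace] at hx ⊢
  intro i
  have h1 : autV P Θ (w x) = w (autV P Θ x) := LinearEquiv.congr_fun hcomm x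
  obtain ⟨j, rfl⟩ := τ.surjective i
  rw [h1, hτ, hτ, hx]

/-- The restriction to the folded space of an element of the fixed-point subgroup. -/
def restrictWeyl [Finite ι] {w : CoweightSpace N ≃ₗ[ℝ] CoweightSpace N}
    (hw : w ∈ fixedWeylGroup P Θ) : foldedSpace P Θ ≃ₗ[ℝ] foldedSpace P Θ :=
  w.ofSubmodules _ _ (le_antisymm
    (Submodule.map_le_iff_le_comap.2 fun _ hx => map_mem_foldedSpace hw hx)
    fun x hx => ⟨w.symm x, map_mem_foldedSpace (inv_mem hw) hx, w.apply_symm_apply x⟩)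

lemma coe_restrictWeyl [Finite ι] {w : CoweightSpace N ≃ₗ[ℝ] CoweightSpace N}
    (hw : w ∈ fixedWeylGroup P Θ) (x : foldedSpace P Θ) :
    (restrictWeyl hw x : CoweightSpace N) = w x := rfl

lemma coe_restrictWeyl_symm [Finite ι] {w : CoweightSpace N ≃ₗ[ℝ] CoweightSpace N}
    (hw : w ∈ fixedWeylGroup P Θ) (x : foldedSpace P Θ) :
    ((restrictWeyl hw).symm x : CoweightSpace N) = w.symm x := by
  rw [LinearEquiv.eq_symm_apply, ← coe_restrictWeyl hw, LinearEquiv.apply_symm_apply]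

variable {w : CoweightSpace N ≃ₗ[ℝ] CoweightSpace N} {τ : Equiv.Perm ι}

lemma rootFun_perm (hτ : ∀ i x, rootFun P (τ i) (w x) = rootFun P i x) (i : ι)
    (x : CoweightSpace N) : rootFun P i (w.symm x) = rootFun P (τ i) x := by
  rw [← hτ, LinearEquiv.apply_symm_apply]

lemma rootFun_perm_neg (hτ : ∀ i x, rootFun P (τ i) (w x) = rootFun P i x) (i : ι) :
    rootFun P (τ (P.reflectionPerm i i)) = -rootFun P (τ i) := by
  refine LinearMap.ext fun x => ?_
  rw [← rootFun_perm hτ, rootFun_neg, LinearMap.neg_apply, LinearMap.neg_apply, rootFun_perm hτ]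

lemma mem_movedPositiveRoots_iff [Module.Finite ℤ N]
    (hτ : ∀ i x, rootFun P (τ i) (w x) = rootFun P i x) {f : Module.Dual ℝ (CoweightSpace N)} :
    f ∈ movedPositiveRoots (roots P) (simpleRoots P b) w ↔
      ∃ i, b.IsPos i ∧ f = rootFun P (τ i) := by
  have h : ∀ i, rootFun P i ∘ₗ (w.symm : CoweightSpace N →ₗ[ℝ] CoweightSpace N) =
      rootFun P (τ i) := fun i => LinearMap.ext fun x => rootFun_perm hτ i x
  constructor
  · rintro ⟨g, hg, rfl⟩
    obtain ⟨i, hi, rfl⟩ := mem_positiveRoots_iff.1 hg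
    exact ⟨i, hi, h i⟩
  · rintro ⟨i, hi, rfl⟩
    exact ⟨_, mem_positiveRoots_iff.2 ⟨i, hi, rfl⟩, h i⟩

variable [Finite ι]

/-- `w` preserves the folded space, so it transports proportionality relations between restricted
roots in both directions. -/
lemma isLong_perm_iff (hw : w ∈ fixedWeylGroup P Θ)
    (hτ : ∀ i x, rootFun P (τ i) (w x) = rootFun P i x) {i : ι} :
    IsLong P Θ (τ i) ↔ IsLong P Θ i := by
  constructor
  · intro h j c h0 h1 hc
    refine h (τ j) c h0 h1 ?_
    ext x
    have h2 := LinearMap.congr_fun hc ((restrictWeyl hw).symm x)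
    simp only [restrictedRoot_apply, LinearMap.smul_apply, coe_restrictWeyl_symm,
      rootFun_perm hτ] at h2 ⊢
    exact h2
  · intro h j c h0 h1 hc
    obtain ⟨j, rfl⟩ := τ.surjective j
    refine h j c h0 h1 ?_
    ext x
    have h2 := LinearMap.congr_fun hc (restrictWeyl hw x)
    simp only [restrictedRoot_apply, LinearMap.smul_apply, coe_restrictWeyl, hτ] at h2 ⊢
    exact h2

lemma mem_movedPositiveRoots_folded_iff [Module.Finite ℤ N]
    (hΘ : ∀ i, i ∈ b.support → Θ.indexEquiv i ∈ b.support) (hw : w ∈ fixedWeylGroup P Θ)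
    (hτ : ∀ i x, rootFun P (τ i) (w x) = rootFun P i x)
    {f : Module.Dual ℝ (foldedSpace P Θ)} :
    f ∈ movedPositiveRoots (foldedRoots P Θ) (foldedSimpleRoots P b Θ) (restrictWeyl hw) ↔
      ∃ i, b.IsPos i ∧ IsLong P Θ i ∧ f = restrictedRoot P Θ (τ i) := by
  have h : ∀ i, restrictedRoot P Θ i ∘ₗ
      ((restrictWeyl hw).symm : foldedSpace P Θ →ₗ[ℝ] foldedSpace P Θ) =
      restrictedRoot P Θ (τ i) := fun i => LinearMap.ext fun x => by
    rw [LinearMap.comp_apply, restrictedRoot_apply, restrictedRoot_apply, LinearEquiv.coe_coe,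
      coe_restrictWeyl_symm, rootFun_perm hτ]
  constructor
  · rintro ⟨g, hg, rfl⟩
    obtain ⟨i, hi, hl, rfl⟩ := (mem_foldedPositiveRoots_iff hΘ).1 hg
    exact ⟨i, hi, hl, h i⟩
  · rintro ⟨i, hi, hl, rfl⟩
    exact ⟨_, (mem_foldedPositiveRoots_iff hΘ).2 ⟨i, hi, hl, rfl⟩, h i⟩

end Weyl

/-! ### Acute cones -/

section AcuteCones

variable {ι M N : Type*} [Finite ι] [AddCommGroup M] [AddCommGroup N] [Module.Finite ℤ N]
  {P : RootDatum ι M N} {b : P.Base} {Θ : P.Aut}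
  {w : CoweightSpace N ≃ₗ[ℝ] CoweightSpace N} {τ : Equiv.Perm ι}

omit [Finite ι] [Module.Finite ℤ N] in
/-- Proportional positive roots of a reduced root datum are equal. -/
lemma eq_of_rootFun_eq_smul [P.IsReduced] {i j : ι} (hi : b.IsPos i)
    (hj : b.IsPos j) {c : ℝ} (h : rootFun P j = c • rootFun P i) : j = i := by
  have h1 : (P.pairing j i : ℝ) = 2 * c := by
    rw [← rootFun_corootV, h, LinearMap.smul_apply, rootFun_corootV, P.pairing_same, smul_eq_mul]
    push_cast
    ring
  -- Pairing with the coroot of `i` gives `2c`, an integer, which turns the real relation into an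
  -- integral one with leading coefficient 2.
  have hdep : ¬ LinearIndependent ℤ ![P.root j, P.root i] := by
    rw [LinearIndependent.pair_iff]
    intro hli
    have h2 := hli 2 (-P.pairing j i) (weightFun_injective P (by
      rw [map_add, map_zsmul, map_zsmul, weightFun_root, weightFun_root, map_zero,
        ← Int.cast_smul_eq_zsmul ℝ, ← Int.cast_smul_eq_zsmul ℝ, h, smul_smul, Int.cast_neg, h1]
      push_cast
      module))
    exact absurd h2.1 two_ne_zero
  rcases RootPairing.IsReduced.eq_or_eq_neg j i hdep with h2 | h2
  · exact P.root.injective h2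
  · exfalso
    have h' : P.reflectionPerm i i = j := rootFun_injective P (by
      rw [rootFun_neg, ← weightFun_root, ← weightFun_root, h2, map_neg])
    exact not_isPos_neg hi (h' ▸ hj)

lemma mem_acuteCone_roots_iff [P.IsReduced]
    (hτ : ∀ i x, rootFun P (τ i) (w x) = rootFun P i x) {x y : CoweightSpace N}
    (hx : x ∈ regularSet (roots P)) (hy : y ∈ regularSet (roots P)) :
    floorCell (roots P) y ∈ acuteCone (roots P) (simpleRoots P b) (floorCell (roots P) x) w ↔
      ∀ i, b.IsPos i → ⌊rootFun P (τ i) x⌋ ≤ ⌊rootFun P (τ i) y⌋ := by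
  rw [mem_acuteCone_iff (show (roots P).Finite from Set.finite_range _) continuous_of_mem_roots _ _ _ _ hx hy]
  · constructor
    · exact fun h i hi => h _ ((mem_movedPositiveRoots_iff hτ).2 ⟨i, hi, rfl⟩)
    · intro h α hα
      obtain ⟨i, hi, rfl⟩ := (mem_movedPositiveRoots_iff hτ).1 hα
      exact h i hi
  · rintro _ ⟨i, rfl⟩
    exact rootFun_ne_zero P i
  · intro α hα
    obtain ⟨i, -, rfl⟩ := (mem_movedPositiveRoots_iff hτ).1 hα
    exact ⟨_, rfl⟩
  · rintro _ ⟨i, rfl⟩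
    obtain ⟨i, rfl⟩ := τ.surjective i
    rcases isPos_or_isPos_neg b i with hi | hi
    · exact Or.inl ((mem_movedPositiveRoots_iff hτ).2 ⟨i, hi, rfl⟩)
    · exact Or.inr ((mem_movedPositiveRoots_iff hτ).2 ⟨_, hi, (rootFun_perm_neg hτ i).symm⟩)
  · intro α hα β hβ c hc
    obtain ⟨i, hi, rfl⟩ := (mem_movedPositiveRoots_iff hτ).1 hα
    obtain ⟨j, hj, rfl⟩ := (mem_movedPositiveRoots_iff hτ).1 hβ
    have h : rootFun P j = c • rootFun P i := LinearMap.ext fun x => by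
      rw [LinearMap.smul_apply, ← hτ j, ← hτ i, hc, LinearMap.smul_apply]
    rw [eq_of_rootFun_eq_smul hi hj h]

/-- The gallery criterion speaks of long roots only. A positive root that is not long restricts to
half of a positive long one, so its condition follows, and the criterion becomes the one for `V`. -/
lemma mem_acuteCone_foldedRoots_iff
    (hΘ : ∀ i, i ∈ b.support → Θ.indexEquiv i ∈ b.support) (hw : w ∈ fixedWeylGroup P Θ)
    (hτ : ∀ i x, rootFun P (τ i) (w x) = rootFun P i x) {x y : foldedSpace P Θ}
    (hx : x ∈ regularSet (foldedRoots P Θ)) (hy : y ∈ regularSet (foldedRoots P Θ)) :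
    floorCell (foldedRoots P Θ) y ∈ acuteCone (foldedRoots P Θ) (foldedSimpleRoots P b Θ)
        (floorCell (foldedRoots P Θ) x) (restrictWeyl hw) ↔
      ∀ i, b.IsPos i → ⌊rootFun P (τ i) x⌋ ≤ ⌊rootFun P (τ i) y⌋ := by
  rw [mem_acuteCone_iff (foldedRoots_finite P Θ) continuous_of_mem_foldedRoots _ _ _ _ hx hy]
  · constructor
    · intro h i hi
      by_cases hl : IsLong P Θ i
      · exact h _ ((mem_movedPositiveRoots_folded_iff hΘ hw hτ).2 ⟨i, hi, hl, rfl⟩)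
      · obtain ⟨j, hj, hij⟩ := exists_isLong hΘ hl
        have hjpos : b.IsPos j := by
          obtain ⟨ρ, hρ, hρ1⟩ := exists_foldedRho b Θ hΘ
          have h1 := LinearMap.congr_fun hij ⟨ρ, hρ⟩
          simp only [restrictedRoot_apply, LinearMap.smul_apply, smul_eq_mul,
            rootFun_eq_height b hρ1] at h1
          have h2 : (0 : ℝ) < b.height i := by exact_mod_cast hi
          have h3 : (0 : ℝ) < b.height j := by linarith
          exact_mod_cast h3
        refine floor_le_of_eq_half (i := τ i) (j := τ j) ?_
          (h _ ((mem_movedPositiveRoots_folded_iff hΘ hw hτ).2 ⟨j, hjpos, hj, rfl⟩))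
        ext z
        have h2 := LinearMap.congr_fun hij ((restrictWeyl hw).symm z)
        simp only [restrictedRoot_apply, LinearMap.smul_apply, coe_restrictWeyl_symm,
          rootFun_perm hτ] at h2 ⊢
        exact h2
    · intro h α hα
      obtain ⟨i, hi, -, rfl⟩ := (mem_movedPositiveRoots_folded_iff hΘ hw hτ).1 hα
      exact h i hi
  · intro α hα
    obtain ⟨i, -, rfl⟩ := (mem_foldedRoots P Θ).1 hα
    exact restrictedRoot_ne_zero hΘ i
  · intro α hα
    obtain ⟨i, -, hl, rfl⟩ := (mem_movedPositiveRoots_folded_iff hΘ hw hτ).1 hα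
    exact (mem_foldedRoots P Θ).2 ⟨_, (isLong_perm_iff hw hτ).2 hl, rfl⟩
  · intro α hα
    obtain ⟨i, hl, rfl⟩ := (mem_foldedRoots P Θ).1 hα
    obtain ⟨i, rfl⟩ := τ.surjective i
    rw [isLong_perm_iff hw hτ] at hl
    rcases isPos_or_isPos_neg b i with hi | hi
    · exact Or.inl ((mem_movedPositiveRoots_folded_iff hΘ hw hτ).2 ⟨i, hi, hl, rfl⟩)
    · refine Or.inr ((mem_movedPositiveRoots_folded_iff hΘ hw hτ).2
        ⟨_, hi, isLong_neg hl, ?_⟩)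
      ext z
      rw [restrictedRoot_apply, rootFun_perm_neg hτ]
      rfl
  · intro α hα β hβ c hc
    obtain ⟨i, hi, hli, rfl⟩ := (mem_movedPositiveRoots_folded_iff hΘ hw hτ).1 hα
    obtain ⟨j, hj, hlj, rfl⟩ := (mem_movedPositiveRoots_folded_iff hΘ hw hτ).1 hβ
    have h : restrictedRoot P Θ j = c • restrictedRoot P Θ i := by
      ext z
      have h2 := LinearMap.congr_fun hc (restrictWeyl hw z)
      simp only [restrictedRoot_apply, LinearMap.smul_apply, coe_restrictWeyl, hτ] at h2 ⊢
      exact h2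
    have hcpos : 0 < c := by
      obtain ⟨ρ, hρ, hρ1⟩ := exists_foldedRho b Θ hΘ
      have h1 := LinearMap.congr_fun h ⟨ρ, hρ⟩
      simp only [restrictedRoot_apply, LinearMap.smul_apply, smul_eq_mul,
        rootFun_eq_height b hρ1] at h1
      have h2 : (0 : ℝ) < b.height i := by exact_mod_cast hi
      have h3 : (0 : ℝ) < b.height j := by exact_mod_cast hj
      rw [h1] at h3
      exact pos_of_mul_pos_left h3 h2.le
    rw [hc, eq_one_of_isLong hlj hli hcpos h, one_smul]

end AcuteCones

end FoldedAlcoves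

end

-- The four claims, read off from integer parts.

open FoldedAlcoves
theorem proposition9p3 {ι M N : Type*} [Finite ι] [AddCommGroup M] [AddCommGroup N]
    [Module.Finite ℤ M] [Module.Finite ℤ N]
    (P : RootDatum ι M N) [P.IsReduced] (hP : IsIrreducibleDatum P) (b : P.Base)
    (Θ : P.Aut) (hΘ : ∀ i, i ∈ b.support → Θ.indexEquiv i ∈ b.support) :
    -- an alcove of V meets the folded space in the empty set or in an alcove
    (∀ A : Set (CoweightSpace N), IsAlcove (roots P) A →
      interFolded P Θ A = ∅ ∨ IsAlcove (foldedRoots P Θ) (interFolded P Θ A)) ∧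
    -- every alcove of the folded space arises from a unique alcove of V
    (∀ A' : Set (foldedSpace P Θ), IsAlcove (foldedRoots P Θ) A' →
      ∃! A : Set (CoweightSpace N), IsAlcove (roots P) A ∧ A' = interFolded P Θ A) ∧
    -- base alcoves
    (baseAlcove (foldedRoots P Θ) (foldedSimpleRoots P b Θ) =
      interFolded P Θ (baseAlcove (roots P) (simpleRoots P b))) ∧
    -- acute cones, with the restriction of w to the folded space
    (∀ w ∈ fixedWeylGroup P Θ, ∃ w' : foldedSpace P Θ ≃ₗ[ℝ] foldedSpace P Θ,
      (∀ x, ((w' x : foldedSpace P Θ) : CoweightSpace N) = w (x : CoweightSpace N)) ∧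
      acuteCone (foldedRoots P Θ) (foldedSimpleRoots P b Θ)
          (baseAlcove (foldedRoots P Θ) (foldedSimpleRoots P b Θ)) w' =
        {A' | IsAlcove (foldedRoots P Θ) A' ∧
          ∃ A ∈ acuteCone (roots P) (simpleRoots P b)
            (baseAlcove (roots P) (simpleRoots P b)) w,
          A' = interFolded P Θ A}) := by 
  have hcont := continuous_of_mem_roots (P := P)
  have hcont' := continuous_of_mem_foldedRoots (P := P) (Θ := Θ)
  refine ⟨fun A hA => ?_, fun A' hA' => ?_, baseAlcove_folded hP hΘ, fun w hw => ?_⟩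
  · rcases Set.eq_empty_or_nonempty (interFolded P Θ A) with h | ⟨x, hx⟩
    · exact Or.inl h
    · right
      have hxA : (x : CoweightSpace N) ∈ A := hx
      have hAx := hA.eq_floorCell hcont hxA
      rw [hAx] at hxA ⊢
      rw [interFolded_floorCell hΘ]
      exact isAlcove_floorCell hcont' ((mem_regularSet_folded hΘ).2 hxA.1)
  · obtain ⟨x, hx, rfl⟩ := (isAlcove_iff hcont').1 hA'
    have hx' := (mem_regularSet_folded hΘ).1 hx
    refine ⟨floorCell (roots P) x, ⟨isAlcove_floorCell hcont hx',
      (interFolded_floorCell hΘ x).symm⟩, ?_⟩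
    rintro B ⟨hB, hBx⟩
    have hxB : x ∈ interFolded P Θ B := by
      rw [← hBx]
      exact self_mem_floorCell hx
    -- An alcove of `V` is the cell of any of its points, so containing `x` determines it.
    exact hB.eq_floorCell hcont hxB
  · obtain ⟨τ, hτ⟩ := exists_perm_of_mem_weylGroupV hw.1
    refine ⟨restrictWeyl hw, coe_restrictWeyl hw, ?_⟩
    -- Both base alcoves are cells of one point of the folded space, so both cone criteria can be
    -- tested from it.
    obtain ⟨x, hx, hbase⟩ := exists_baseAlcove_eq_floorCell (b := b) hP hΘ
    have hx' := (mem_regularSet_folded hΘ).2 hx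
    rw [baseAlcove_folded hP hΘ, hbase, interFolded_floorCell hΘ]
    ext A'
    constructor
    · intro h
      have hA' : IsAlcove (foldedRoots P Θ) A' := by
        obtain ⟨l, g, hg, -, -, rfl⟩ := h
        exact hg.1 l le_rfl
      obtain ⟨y, hy, rfl⟩ := (isAlcove_iff hcont').1 hA'
      rw [mem_acuteCone_foldedRoots_iff hΘ hw hτ hx' hy] at h
      exact ⟨hA', floorCell (roots P) y,
        (mem_acuteCone_roots_iff hτ hx ((mem_regularSet_folded hΘ).1 hy)).2 h,
        (interFolded_floorCell hΘ y).symm⟩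
    · rintro ⟨hA', A, hA, rfl⟩
      obtain ⟨y, hy⟩ := hA'.nonempty
      have hyA : (y : CoweightSpace N) ∈ A := hy
      have hAalc : IsAlcove (roots P) A := by
        obtain ⟨l, g, hg, -, -, rfl⟩ := hA
        exact hg.1 l le_rfl
      have hAy := hAalc.eq_floorCell hcont hyA
      rw [hAy] at hA hyA ⊢
      rw [mem_acuteCone_roots_iff hτ hx hyA.1] at hA
      rw [interFolded_floorCell hΘ, mem_acuteCone_foldedRoots_iff hΘ hw hτ hx'
        ((mem_regularSet_folded hΘ).2 hyA.1)]
      exact hA
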